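/- Let $p$ be a prime, $E$ a field of characteristic $p$, $E^{\mathrm{sep}}$ a separable closure of $E$, $G_E=\mathrm{Gal}(E^{\mathrm{sep}}/E)$ with its profinite topology, and $\sigma(x)=x^p$. Let $\mathrm{Rep}_{\mathbb F_p}(G_E)$ be the category of finite dimensional $\mathbb F_p$-vector spaces (with the discrete topology) with a continuous linear action of $G_E$. An étale $\varphi$-module over $E$ is a finite dimensional $E$-vector space $M$ with a $\sigma$-semilinear map $\varphi:M\to M$ whose image generates $M$ over $E$; morphisms are the $E$-linear maps commuting with $\varphi$. For $V\in\mathrm{Rep}_{\mathbb F_p}(G_E)$ the space $D(V)=(E^{\mathrm{sep}}\otimes_{\mathbb F_p}V)^{G_E}$, with $\varphi$ induced by $\sigma\otimes\mathrm{id}_V$, is an étale $\varphi$-module, functorially in $V$. For an étale $\varphi$-module $M$ let $\mathcal H^i(M)$, $i\ge 0$, be the cohomology of the complex of abelian groups $$0\to M\xrightarrow{\ \varphi-1\ }M\to 0\qquad(M\text{ in degrees }0\text{ and }1);$$ with the connecting maps of the snake lemma, $(\mathcal H^i)_{i\ge0}$ is a cohomological functor ($\delta$-functor) from étale $\varphi$-modules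 to abelian groups. Then the functor $D$ is exact, so that $(\mathcal H^i\circ D)_{i\ge 0}$ is a cohomological functor on $\mathrm{Rep}_{\mathbb F_p}(G_E)$, and this cohomological functor is isomorphic to the (continuous) Galois cohomology functor $(H^i(G_E,\cdot))_{i\ge 0}$: there are isomorphisms $\mathcal H^i(D(V))\cong H^i(G_E,V)$ for all $i\ge0$, natural in $V$ and compatible with the connecting homomorphisms of all short exact sequences in $\mathrm{Rep}_{\mathbb F_p}(G_E)$. They can be chosen so that in degree $0$ one has the canonical identification $D(V)^{\varphi=1}\cong V^{G_E}$, $1\otimes v\leftrightarrow v$. -/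

import Mathlib

open CategoryTheory
open scoped TensorProduct

universe u

noncomputable section

/-! ### Cohomological functors -/

section DeltaFunctors

variable {C : Type*} [Category C] [Preadditive C]

/-- A cohomological functor (`δ`-functor) `(Hⁿ)` indexed by `n : ℕ`, from an additive category `C`
with a given class `ex` of short exact sequences to an abelian category `A`. -/
structure DeltaFunctor (ex : ShortComplex C → Prop) (A : Type*) [Category A] [Abelian A] where
  /-- the functors `Hⁿ` -/
  H : ℕ → C ⥤ A
  additive : ∀ n, (H n).Additive
  /-- the connecting morphisms `Hⁿ(X₃) ⟶ Hⁿ⁺¹(X₁)` -/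
  δ : ∀ (S : ShortComplex C), ex S → ∀ n, (H n).obj S.X₃ ⟶ (H (n + 1)).obj S.X₁
  δ_naturality : ∀ {S T : ShortComplex C} (hS : ex S) (hT : ex T) (f : S ⟶ T) (n : ℕ),
    δ S hS n ≫ (H (n + 1)).map f.τ₁ = (H n).map f.τ₃ ≫ δ T hT n
  mono_zero : ∀ {S : ShortComplex C}, ex S → Mono ((H 0).map S.f)
  exact₂ : ∀ {S : ShortComplex C}, ex S → ∀ n, (S.map (H n)).Exact
  comp_δ : ∀ {S : ShortComplex C} (hS : ex S) (n : ℕ), (H n).map S.g ≫ δ S hS n = 0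
  exact₃ : ∀ {S : ShortComplex C} (hS : ex S) (n : ℕ), (ShortComplex.mk _ _ (comp_δ hS n)).Exact
  δ_comp : ∀ {S : ShortComplex C} (hS : ex S) (n : ℕ), δ S hS n ≫ (H (n + 1)).map S.f = 0
  exact₁ : ∀ {S : ShortComplex C} (hS : ex S) (n : ℕ), (ShortComplex.mk _ _ (δ_comp hS n)).Exact

namespace DeltaFunctor

variable {ex : ShortComplex C → Prop} {A : Type*} [Category A] [Abelian A]

/-- The cohomology of a functorial cochain complex that turns short exact sequences into
short exact sequences of complexes, with the connecting morphisms of the snake lemma. -/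
def ofComplexes (F : C ⥤ CochainComplex A ℕ) [F.Additive]
    (hF : ∀ S, ex S → (S.map F).ShortExact) : DeltaFunctor ex A where
  H n := F ⋙ HomologicalComplex.homologyFunctor A (ComplexShape.up ℕ) n
  additive _ := inferInstance
  δ S hS n := (hF S hS).δ n (n + 1) rfl
  δ_naturality {S T} hS hT f n := HomologicalComplex.HomologySequence.δ_naturality
    (F.mapShortComplex.map f) (hF S hS) (hF T hT) n (n + 1) rfl
  mono_zero {S} hS := by
    have h := hF S hS
    have : Mono (HomologicalComplex.homologyMap (S.map F).f 0) := by
      have := h.mono_f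
      have h₁ : Mono (HomologicalComplex.cyclesMap (S.map F).f 0) := inferInstance
      have h₂ : ∀ K : CochainComplex A ℕ, IsIso (K.homologyπ 0) := fun K => inferInstance
      have h₃ : HomologicalComplex.homologyMap (S.map F).f 0 =
          inv ((S.map F).X₁.homologyπ 0) ≫ HomologicalComplex.cyclesMap (S.map F).f 0 ≫
            (S.map F).X₂.homologyπ 0 := by
        rw [← HomologicalComplex.homologyπ_naturality, IsIso.inv_hom_id_assoc]
      rw [h₃]
      infer_instance
    exact this
  exact₂ hS n := (hF _ hS).homology_exact₂ n
  comp_δ hS n := (hF _ hS).comp_δ n (n + 1) rfl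
  exact₃ hS n := (hF _ hS).homology_exact₃ n (n + 1) rfl
  δ_comp hS n := (hF _ hS).δ_comp n (n + 1) rfl
  exact₁ hS n := (hF _ hS).homology_exact₁ n (n + 1) rfl

/-- The composite of a cohomological functor with an exact additive functor. -/
def comp (T : DeltaFunctor ex A) {C' : Type*} [Category C'] [Preadditive C']
    {ex' : ShortComplex C' → Prop} (D : C' ⥤ C) [D.Additive]
    (hD : ∀ S, ex' S → ex (S.map D)) : DeltaFunctor ex' A where
  H n := D ⋙ T.H n
  additive n := by
    have := T.additive n
    infer_instance
  δ S hS n := T.δ (S.map D) (hD S hS) n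
  δ_naturality {S S'} hS hS' f n :=
    T.δ_naturality (hD S hS) (hD S' hS') (D.mapShortComplex.map f) n
  mono_zero hS := T.mono_zero (hD _ hS)
  exact₂ hS n := T.exact₂ (hD _ hS) n
  comp_δ hS n := T.comp_δ (hD _ hS) n
  exact₃ hS n := T.exact₃ (hD _ hS) n
  δ_comp hS n := T.δ_comp (hD _ hS) n
  exact₁ hS n := T.exact₁ (hD _ hS) n

/-- An isomorphism of cohomological functors: natural isomorphisms in all degrees that commute
with the connecting morphisms. -/
structure Iso (T T' : DeltaFunctor ex A) where
  iso : ∀ n, T.H n ≅ T'.H n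
  comm : ∀ (S : ShortComplex C) (hS : ex S) (n : ℕ),
    T.δ S hS n ≫ (iso (n + 1)).hom.app S.X₁ = (iso n).hom.app S.X₃ ≫ T'.δ S hS n

end DeltaFunctor

end DeltaFunctors

/-! ### Étale `φ`-modules -/

/-- An étale `φ`-module over a field `E` of characteristic `p`: a finite dimensional vector space
with a Frobenius-semilinear endomorphism whose image generates it. -/
structure EtalePhiModule (p : ℕ) (E : Type u) [Field E] [ExpChar E p] where
  carrier : Type u
  [addCommGroup : AddCommGroup carrier]
  [module : Module E carrier]
  [finite : Module.Finite E carrier]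
  φ : carrier →ₛₗ[frobenius E p] carrier
  span_range : Submodule.span E (Set.range φ) = ⊤

namespace EtalePhiModule

attribute [instance] addCommGroup module finite

variable {p : ℕ} {E : Type u} [Field E] [ExpChar E p]

/-- Morphisms of étale `φ`-modules: linear maps commuting with `φ`. -/
@[ext]
structure Hom (M N : EtalePhiModule p E) where
  lin : M.carrier →ₗ[E] N.carrier
  comm : ∀ x, lin (M.φ x) = N.φ (lin x)

instance : Category (EtalePhiModule p E) where
  Hom := Hom
  id M := ⟨LinearMap.id, fun _ => rfl⟩
  comp f g := ⟨g.lin ∘ₗ f.lin, fun x => by simp [f.comm, g.comm]⟩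

@[ext]
theorem hom_ext {M N : EtalePhiModule p E} {f g : M ⟶ N} (h : f.lin = g.lin) : f = g :=
  Hom.ext h

@[simp]
theorem id_lin (M : EtalePhiModule p E) : (𝟙 M : M ⟶ M).lin = LinearMap.id := rfl

@[simp]
theorem comp_lin {M N P : EtalePhiModule p E} (f : M ⟶ N) (g : N ⟶ P) :
    (f ≫ g).lin = g.lin ∘ₗ f.lin := rfl

variable {M N : EtalePhiModule p E}

instance : Zero (M ⟶ N) := ⟨⟨0, fun x => by simp⟩⟩
instance : Add (M ⟶ N) := ⟨fun f g => ⟨f.lin + g.lin, fun x => by simp [f.comm, g.comm]⟩⟩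
instance : Neg (M ⟶ N) := ⟨fun f => ⟨-f.lin, fun x => by simp [f.comm]⟩⟩
instance : Sub (M ⟶ N) := ⟨fun f g => ⟨f.lin - g.lin, fun x => by simp [f.comm, g.comm]⟩⟩
instance : SMul ℕ (M ⟶ N) := ⟨fun n f => ⟨n • f.lin, fun x => by simp [f.comm]⟩⟩
instance : SMul ℤ (M ⟶ N) := ⟨fun n f => ⟨n • f.lin, fun x => by simp [f.comm]⟩⟩

instance : AddCommGroup (M ⟶ N) :=
  Function.Injective.addCommGroup (fun f : M ⟶ N => f.lin) (fun _ _ h => hom_ext h)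
    rfl (fun _ _ => rfl) (fun _ => rfl) (fun _ _ => rfl) (fun _ _ => rfl) (fun _ _ => rfl)

@[simp]
theorem add_lin (f g : M ⟶ N) : (f + g).lin = f.lin + g.lin := rfl

@[simp]
theorem zero_lin : (0 : M ⟶ N).lin = 0 := rfl

instance : Preadditive (EtalePhiModule p E) where
  add_comp _ _ _ f f' g := by ext x; simp
  comp_add _ _ _ f g g' := by ext x; simp

/-- Short exact sequences of étale `φ`-modules. -/
def IsShortExact (S : ShortComplex (EtalePhiModule p E)) : Prop :=
  Function.Injective S.f.lin ∧ Function.Exact S.f.lin S.g.lin ∧ Function.Surjective S.g.lin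

/-- The additive map `φ - 1`. -/
def phiSubOne (M : EtalePhiModule p E) : M.carrier →+ M.carrier :=
  (M.φ : M.carrier →+ M.carrier) - AddMonoidHom.id M.carrier

/-- The terms of the complex `0 ⟶ M ⟶ M ⟶ 0`, with `M` in degrees `0` and `1`. -/
def complexX (M : EtalePhiModule p E) : ℕ → AddCommGrpCat.{u}
  | 0 => AddCommGrpCat.of M.carrier
  | 1 => AddCommGrpCat.of M.carrier
  | _ + 2 => AddCommGrpCat.of PUnit

theorem isZero_complexX (M : EtalePhiModule p E) (n : ℕ) : Limits.IsZero (M.complexX (n + 2)) :=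
  AddCommGrpCat.isZero_of_subsingleton (AddCommGrpCat.of PUnit.{u + 1})

/-- The differentials `φ - 1 : M ⟶ M` and `0`. -/
def complexD (M : EtalePhiModule p E) : ∀ n, M.complexX n ⟶ M.complexX (n + 1)
  | 0 => AddCommGrpCat.ofHom M.phiSubOne
  | _ + 1 => 0

/-- The maps induced on the terms of the complexes. -/
def complexMap (f : M ⟶ N) : ∀ n, M.complexX n ⟶ N.complexX n
  | 0 => AddCommGrpCat.ofHom f.lin.toAddMonoidHom
  | 1 => AddCommGrpCat.ofHom f.lin.toAddMonoidHom
  | _ + 2 => 0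

/-- The functor sending `M` to the complex of abelian groups `M ⟶ M`, with differential `φ - 1`,
placed in degrees `0` and `1`. -/
def complex (p : ℕ) (E : Type u) [Field E] [ExpChar E p] :
    EtalePhiModule p E ⥤ CochainComplex AddCommGrpCat.{u} ℕ where
  obj M := CochainComplex.of M.complexX M.complexD (fun n => by
    cases n <;> exact Limits.comp_zero)
  map {M N} f := CochainComplex.ofHom (complexMap f) (fun n => by
    rcases n with (_ | n)
    · ext x
      exact (congrArg (· - f.lin x) (f.comm x).symm).trans (map_sub f.lin (M.φ x) x).symm
    · exact (N.isZero_complexX n).eq_of_tgt _ _)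
  map_id M := by
    ext n : 1
    rcases n with (_ | _ | n)
    · rfl
    · rfl
    · exact (M.isZero_complexX n).eq_of_tgt _ _
  map_comp {M N P} f g := by
    ext n : 1
    rcases n with (_ | _ | n)
    · rfl
    · rfl
    · exact (P.isZero_complexX n).eq_of_tgt _ _

instance : (complex p E).Additive where
  map_add {M N f g} := by
    ext n : 1
    rcases n with (_ | _ | n)
    · rfl
    · rfl
    · exact (N.isZero_complexX n).eq_of_tgt _ _

theorem complex_shortExact (S : ShortComplex (EtalePhiModule p E)) (hS : IsShortExact S) :
    (S.map (complex p E)).ShortExact := by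
  obtain ⟨h₁, h₂, h₃⟩ := hS
  refine HomologicalComplex.shortExact_of_degreewise_shortExact _ fun n => ?_
  rcases n with (_ | _ | n)
  · exact
      { exact := (ShortComplex.ab_exact_iff_function_exact _).2 h₂
        mono_f := (AddCommGrpCat.mono_iff_injective _).2 h₁
        epi_g := (AddCommGrpCat.epi_iff_surjective _).2 h₃ }
  · exact
      { exact := (ShortComplex.ab_exact_iff_function_exact _).2 h₂
        mono_f := (AddCommGrpCat.mono_iff_injective _).2 h₁
        epi_g := (AddCommGrpCat.epi_iff_surjective _).2 h₃ }
  · exact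
      { exact := ShortComplex.exact_of_isZero_X₂ _ (S.X₂.isZero_complexX n)
        mono_f := ⟨fun _ _ _ => (S.X₁.isZero_complexX n).eq_of_tgt _ _⟩
        epi_g := ⟨fun _ _ _ => (S.X₃.isZero_complexX n).eq_of_src _ _⟩ }

/-- The cohomological functor `M ↦ Hⁱ(M --(φ - 1)--> M)` on étale `φ`-modules. -/
def cohomology (p : ℕ) (E : Type u) [Field E] [ExpChar E p] :
    DeltaFunctor (IsShortExact (p := p) (E := E)) AddCommGrpCat.{u} :=
  DeltaFunctor.ofComplexes (complex p E) complex_shortExact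

/-- `c` is the class in `H⁰` of the element `m` of `M`; in particular `φ m = m`. -/
def IsClassOf {M : EtalePhiModule p E} (c : ((cohomology p E).H 0).obj M) (m : M.carrier) : Prop :=
  ∃ z : ((complex p E).obj M).cycles 0,
    ((complex p E).obj M).iCycles 0 z = m ∧ ((complex p E).obj M).homologyπ 0 z = c

end EtalePhiModule

/-! ### Mod `p` representations and their continuous cohomology -/

section Representations

variable (p : ℕ) (G : Type u) [Group G] [TopologicalSpace G]

/-- The finite dimensional discrete `𝔽_p`-vector spaces on which `G` acts continuously. -/
def IsModPRep : ObjectProperty (TopRep.{u} (ZMod p) G) := fun V =>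
  DiscreteTopology V ∧ Module.Finite (ZMod p) V ∧ Continuous (fun x : G × V => V.ρ x.1 x.2)

/-- The category of mod `p` representations of the topological group `G`. -/
abbrev ModPRep : Type (u + 1) := (IsModPRep p G).FullSubcategory

variable {p G}

/-- Short exact sequences of mod `p` representations. -/
def ModPRep.IsShortExact (S : ShortComplex (ModPRep p G)) : Prop :=
  Function.Injective S.f.hom.hom ∧ Function.Exact S.f.hom.hom S.g.hom.hom ∧
    Function.Surjective S.g.hom.hom

/-- The underlying abelian group of a topological `𝔽_p`-module. -/
abbrev topModuleForget (p : ℕ) : TopModuleCat.{u} (ZMod p) ⥤ AddCommGrpCat.{u} :=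
  forget₂ (TopModuleCat.{u} (ZMod p)) (ModuleCat.{u} (ZMod p)) ⋙
    forget₂ (ModuleCat.{u} (ZMod p)) AddCommGrpCat.{u}

instance : (topModuleForget.{u} p).Additive where
  map_add := rfl

namespace ModPRep

open TopRep

variable [IsTopologicalGroup G]

/-- The continuous homogeneous cochains, as a functor to complexes of abelian groups. -/
def cochains (p : ℕ) (G : Type u) [Group G] [TopologicalSpace G] [IsTopologicalGroup G] :
    TopRep.{u} (ZMod p) G ⥤ CochainComplex AddCommGrpCat.{u} ℕ where
  obj V := ((topModuleForget p).mapHomologicalComplex _).obj (homogeneousCochains V)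
  map {V W} f := ((topModuleForget p).mapHomologicalComplex _).map
    (ContinuousCohomology.cochainsMap (X := V) (Y := W) (ContinuousMonoidHom.id G) f)
  map_id V := by
    rw [ContinuousCohomology.cochainsMap_id, CategoryTheory.Functor.map_id]
  map_comp {V W X} f g := by
    rw [← CategoryTheory.Functor.map_comp]
    exact congrArg _ (ContinuousCohomology.cochainsMap_comp (X := V) (Y := W) (Z := X)
      (ContinuousMonoidHom.id G) (ContinuousMonoidHom.id G) f g)

/-- The map induced by `f` on iterated function spaces `C(G, C(G, ⋯))`. -/
abbrev resMap {V W : TopRep.{u} (ZMod p) G} (f : V ⟶ W) (n : ℕ) :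
    resolutionX V n ⟶ resolutionX W n :=
  ContinuousCohomology.resolutionMap (X := V) (Y := W) (ContinuousMonoidHom.id G) f n

theorem resMap_succ_apply {V W : TopRep.{u} (ZMod p) G} (f : V ⟶ W) (n : ℕ)
    (F : C(G, resolutionX V n)) (x : G) :
    ((resMap f (n + 1)).hom F : C(G, resolutionX W n)) x = (resMap f n).hom (F x) := rfl

theorem resMap_add {V W : TopRep.{u} (ZMod p) G} (f g : V ⟶ W) (n : ℕ)
    (F : resolutionX V n) :
    (resMap (f + g) n).hom F = (resMap f n).hom F + (resMap g n).hom F := by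
  induction n with
  | zero => rfl
  | succ n ih => exact ContinuousMap.ext fun x => ih (F x)

instance : (cochains p G).Additive where
  map_add {V W f g} := by
    ext n F
    exact Subtype.ext (resMap_add f g (n + 1) F.1)

section Exactness

variable {X Y Z : TopRep.{u} (ZMod p) G} (f : X ⟶ Y) (g : Y ⟶ Z)

theorem isEmbedding_resMap (hf : Topology.IsEmbedding f.hom) (n : ℕ) :
    Topology.IsEmbedding (resMap f n).hom := by
  induction n with
  | zero => exact hf
  | succ n ih =>
    exact ContinuousMap.isEmbedding_postcomp
      (⟨(resMap f n).hom, ih.continuous⟩ : C(resolutionX X n, resolutionX Y n)) ih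

theorem exact_resMap (hf : Topology.IsEmbedding f.hom) (h : Function.Exact f.hom g.hom) (n : ℕ) :
    Function.Exact (resMap f n).hom (resMap g n).hom := by
  induction n with
  | zero => exact h
  | succ n ih =>
    intro F
    constructor
    · intro hF
      have hF' : ∀ x, ∃ a, (resMap f n).hom a = (F : C(G, resolutionX Y n)) x := fun x =>
        (ih _).1 (DFunLike.congr_fun (show (resMap g (n + 1)).hom F =
          (0 : C(G, resolutionX Z n)) from hF) x)
      choose k hk using hF'
      have hk' : Continuous k := by
        rw [(isEmbedding_resMap f hf n).continuous_iff]
        exact (F : C(G, resolutionX Y n)).continuous.congr fun x => (hk x).symm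
      exact ⟨(⟨k, hk'⟩ : C(G, resolutionX X n)), ContinuousMap.ext hk⟩
    · rintro ⟨k, rfl⟩
      exact ContinuousMap.ext fun x => (ih _).2 ⟨(k : C(G, resolutionX X n)) x, rfl⟩

theorem exists_section_resMap (hg : ∃ s : C(Z, Y), ∀ z, g.hom (s z) = z) (n : ℕ) :
    ∃ s : C(resolutionX Z n, resolutionX Y n), ∀ z, (resMap g n).hom (s z) = z := by
  induction n with
  | zero => exact hg
  | succ n ih =>
    obtain ⟨s, hs⟩ := ih
    exact ⟨⟨fun F : C(G, resolutionX Z n) => s.comp F, ContinuousMap.continuous_postcomp s⟩,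
      fun F => ContinuousMap.ext fun x => hs _⟩

theorem continuous_resolutionX [LocallyCompactSpace G]
    (hX : Continuous (fun x : G × X => X.ρ x.1 x.2)) (n : ℕ) :
    Continuous (fun x : G × resolutionX X n => (resolutionX X n).ρ x.1 x.2) := by
  induction n with
  | zero => exact hX
  | succ n ih =>
    refine ContinuousMap.continuous_of_continuous_uncurry
      (fun x : G × C(G, resolutionX X n) => ((resolutionX X n).ρ.coind₁ x.1 x.2)) ?_
    have h : Continuous fun q : (G × C(G, resolutionX X n)) × G =>
        (q.1.1, q.1.2 (q.1.1⁻¹ * q.2)) := by fun_prop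
    exact ih.comp h

theorem cochains_shortExact [LocallyCompactSpace G] (S : ShortComplex (ModPRep p G))
    (hS : ModPRep.IsShortExact S) :
    (S.map ((IsModPRep p G).ι ⋙ cochains p G)).ShortExact := by
  obtain ⟨h₁, h₂, h₃⟩ := hS
  have := S.X₁.property.1
  have := S.X₂.property.1
  have := S.X₃.property.1
  have hf : Topology.IsEmbedding S.f.hom.hom :=
    (Topology.IsClosedEmbedding.of_continuous_injective_isClosedMap
      continuous_of_discreteTopology h₁ fun _ _ => isClosed_discrete _).isEmbedding
  have hg : ∃ s : C(S.X₃.obj, S.X₂.obj), ∀ z, S.g.hom.hom (s z) = z :=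
    ⟨⟨Function.surjInv h₃, continuous_of_discreteTopology⟩, Function.surjInv_eq h₃⟩
  refine HomologicalComplex.shortExact_of_degreewise_shortExact _ fun n => ?_
  have hfi := (isEmbedding_resMap S.f.hom hf (n + 1)).injective
  have hfg := exact_resMap S.f.hom S.g.hom hf h₂ (n + 1)
  refine
    { exact := (ShortComplex.ab_exact_iff_function_exact _).2 ?_
      mono_f := (AddCommGrpCat.mono_iff_injective _).2 ?_
      epi_g := (AddCommGrpCat.epi_iff_surjective _).2 ?_ }
  · rintro ⟨F, hF⟩
    constructor
    · intro h
      obtain ⟨k, hk⟩ := (hfg F).1 (congrArg Subtype.val h)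
      refine ⟨⟨k, fun x => hfi ?_⟩, Subtype.ext hk⟩
      have := (resMap S.f.hom (n + 1)).hom.isIntertwining x k
      rw [hk] at this
      exact this.trans ((hF x).trans hk.symm)
    · rintro ⟨k, hk⟩
      exact Subtype.ext ((hfg F).2 ⟨k.1, congrArg Subtype.val hk⟩)
  · exact fun a b h => Subtype.ext (hfi (congrArg Subtype.val h))
  · rintro ⟨F, hF⟩
    obtain ⟨s, hs⟩ := exists_section_resMap S.g.hom hg n
    have hc := continuous_resolutionX (X := S.X₂.obj) S.X₂.property.2.2 n
    let a := s ((F : C(G, resolutionX S.X₃.obj n)) 1)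
    let H : C(G, resolutionX S.X₂.obj n) :=
      ⟨fun x => (resolutionX S.X₂.obj n).ρ x a, hc.comp (.prodMk_left a)⟩
    refine ⟨⟨H, fun x => ContinuousMap.ext fun y => ?_⟩, Subtype.ext (ContinuousMap.ext fun y => ?_)⟩
    · change (resolutionX S.X₂.obj n).ρ x ((resolutionX S.X₂.obj n).ρ (x⁻¹ * y) a) =
        (resolutionX S.X₂.obj n).ρ y a
      rw [← mul_apply_eq_comp, ← map_mul, mul_inv_cancel_left]
    · change (resMap S.g.hom n).hom ((resolutionX S.X₂.obj n).ρ y a) =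
        (F : C(G, resolutionX S.X₃.obj n)) y
      have h₄ := (resMap S.g.hom n).hom.isIntertwining y a
      have h₅ : (resolutionX S.X₃.obj n).ρ y ((F : C(G, resolutionX S.X₃.obj n)) (y⁻¹ * y)) =
        (F : C(G, resolutionX S.X₃.obj n)) y := DFunLike.congr_fun (hF y) y
      rw [inv_mul_cancel] at h₅
      exact h₄.trans ((congrArg _ (hs _)).trans h₅)

end Exactness

/-- The cohomological functor `V ↦ Hⁱ(G, V)` (continuous cohomology) on mod `p` representations. -/
def cohomology (p : ℕ) (G : Type u) [Group G] [TopologicalSpace G] [IsTopologicalGroup G]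
    [LocallyCompactSpace G] :
    DeltaFunctor (IsShortExact (p := p) (G := G)) AddCommGrpCat.{u} :=
  DeltaFunctor.ofComplexes ((IsModPRep p G).ι ⋙ cochains p G) cochains_shortExact

/-- `c` is the class in `H⁰(G, V)` of the element `v` of `V`, i.e. of the constant homogeneous
cochain `v`; in particular `v` is `G`-invariant. -/
def IsClassOf [LocallyCompactSpace G] {V : ModPRep p G} (c : ((cohomology p G).H 0).obj V)
    (v : V.obj) : Prop :=
  ∃ z : ((cochains p G).obj V.obj).cycles 0,
    (show (homogeneousCochains V.obj).X 0 from ((cochains p G).obj V.obj).iCycles 0 z).1 =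
      ContinuousMap.const G v ∧ ((cochains p G).obj V.obj).homologyπ 0 z = c

end ModPRep

end Representations
/-! ### The functor `D` -/

section Fontaine

section Descent

variable {p : ℕ} {E Es W : Type u} [Field E] [Field Es] [Algebra E Es] [AddCommGroup W]
  [Module Es W] [Module E W] [IsScalarTower E Es W]

/-- Vectors fixed by a semilinear Galois action that are linearly independent over `E` are linearly
independent over `E^sep`. -/
theorem linearIndependent_of_fixed [IsGalois E Es] (a : Gal(Es/E) → W →+ W)
    (ha : ∀ g (c : Es) x, a g (c • x) = g c • a g x) {ι : Type*} {v : ι → W}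
    (hv : ∀ i g, a g (v i) = v i) (h : LinearIndependent E v) : LinearIndependent Es v := by
  classical
  rw [linearIndependent_iff']
  intro s
  induction s using Finset.induction_on with
  | empty => simp
  | insert j s hj ih =>
    intro c hc
    by_cases hcj : c j = 0
    · rw [Finset.sum_insert hj, hcj, zero_smul, zero_add] at hc
      intro i hi
      rcases Finset.mem_insert.1 hi with rfl | hi
      · exact hcj
      · exact ih c hc i hi
    · exfalso
      let d : ι → Es := fun i => (c j)⁻¹ * c i
      have hdj : d j = 1 := inv_mul_cancel₀ hcj
      have hd : ∑ i ∈ insert j s, d i • v i = 0 := by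
        simp only [d, mul_smul, ← Finset.smul_sum, hc, smul_zero]
      have hfix : ∀ i ∈ insert j s, ∃ e : E, algebraMap E Es e = d i := by
        intro i hi
        rcases Finset.mem_insert.1 hi with rfl | hi
        · exact ⟨1, by rw [hdj, map_one]⟩
        · refine (InfiniteGalois.mem_range_algebraMap_iff_fixed _).2 fun g => ?_
          have h₁ : ∑ i ∈ insert j s, g (d i) • v i = 0 := by
            have := congrArg (a g) hd
            simpa only [map_sum, ha, map_zero, hv] using this
          have h₂ : ∑ i ∈ s, (g (d i) - d i) • v i = 0 := by
            simp only [sub_smul, Finset.sum_sub_distrib]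
            rw [Finset.sum_insert hj, hdj] at hd h₁
            rw [map_one] at h₁
            exact sub_eq_zero.2 (add_left_cancel (h₁.trans hd.symm))
          exact sub_eq_zero.1 (ih _ h₂ i hi)
      choose! e he using hfix
      have h₃ : ∑ i ∈ insert j s, e i • v i = 0 := by
        rw [← hd]
        exact Finset.sum_congr rfl fun i hi => by rw [← he i hi, algebraMap_smul]
      have h₄ := linearIndependent_iff'.1 h _ _ h₃ j (Finset.mem_insert_self j s)
      have h₅ := he j (Finset.mem_insert_self j s)
      rw [h₄, hdj, map_zero] at h₅
      exact zero_ne_one h₅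

/-- The space of fixed vectors is finite dimensional. -/
theorem finite_of_fixed [IsGalois E Es] [Module.Finite Es W] (a : Gal(Es/E) → W →+ W)
    (ha : ∀ g (c : Es) x, a g (c • x) = g c • a g x) (D : Submodule E W)
    (hD : ∀ x ∈ D, ∀ g, a g x = x) : Module.Finite E D := by
  let b := Module.Basis.ofVectorSpace E D
  have h : LinearIndependent E (fun i => (b i : W)) :=
    b.linearIndependent.map' D.subtype (Submodule.ker_subtype _)
  have := (linearIndependent_of_fixed a ha (fun i => hD _ (b i).2) h).finite
  exact Module.Finite.of_basis b

/-- A Frobenius-semilinear map whose image generates a finite dimensional space preserves linear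
independence. -/
theorem linearIndependent_frobenius [Module.Finite Es W] (F : W →+ W)
    (hF : ∀ (c : Es) x, F (c • x) = c ^ p • F x) (hs : Submodule.span Es (Set.range F) = ⊤)
    {ι : Type*} {v : ι → W} (h : LinearIndependent Es v) :
    LinearIndependent Es (fun i => F (v i)) := by
  have hr : LinearIndepOn Es id (Set.range v) := h.linearIndepOn_id
  let b := Module.Basis.extend hr
  have := FiniteDimensional.fintypeBasisIndex b
  have h₁ : ⊤ ≤ Submodule.span Es (Set.range fun i => F (b i)) := by
    rw [← hs, Submodule.span_le]
    rintro _ ⟨x, rfl⟩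
    rw [← b.sum_repr x, map_sum]
    refine Submodule.sum_mem _ fun i _ => ?_
    rw [hF]
    exact Submodule.smul_mem _ _ (Submodule.subset_span ⟨i, rfl⟩)
  have h₂ := linearIndependent_of_top_le_span_of_card_eq_finrank h₁
    (Module.finrank_eq_card_basis b).symm
  let k : ι → hr.extend (Set.subset_univ _) := fun i =>
    ⟨v i, hr.subset_extend _ (Set.mem_range_self i)⟩
  have hk : ∀ i, b (k i) = v i := fun i => Module.Basis.extend_apply_self hr _
  have h₃ := h₂.comp k fun i j hij => h.injective (congrArg Subtype.val hij)
  simpa only [Function.comp_def, hk] using h₃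

/-- A Frobenius-semilinear map generates the space of fixed vectors. -/
theorem span_of_fixed [ExpChar E p] [IsGalois E Es] [Module.Finite Es W] (a : Gal(Es/E) → W →+ W)
    (ha : ∀ g (c : Es) x, a g (c • x) = g c • a g x) (D : Submodule E W)
    (hD : ∀ x ∈ D, ∀ g, a g x = x) (F : W →+ W)
    (hF : ∀ (c : Es) x, F (c • x) = c ^ p • F x) (hs : Submodule.span Es (Set.range F) = ⊤)
    (φ : D →ₛₗ[frobenius E p] D) (hφ : ∀ x, (φ x : W) = F x) :
    Submodule.span E (Set.range φ) = ⊤ := by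
  have := finite_of_fixed a ha D hD
  let b := Module.finBasis E D
  have h₁ : LinearIndependent E (fun i => (b i : W)) :=
    b.linearIndependent.map' D.subtype (Submodule.ker_subtype _)
  have h₂ := (linearIndependent_frobenius F hF hs
    (linearIndependent_of_fixed a ha (fun i => hD _ (b i).2) h₁)).restrict_scalars
    (R := E) (fun c d h => by simpa [Algebra.smul_def] using h)
  have h₃ : LinearIndependent E (fun i => φ (b i)) := by
    refine LinearIndependent.of_comp D.subtype ?_
    convert h₂ using 1
    exact funext fun i => hφ _
  refine top_le_iff.1 ((h₃.span_eq_top_of_card_eq_finrank' (by simp)).symm.le.trans ?_)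
  exact Submodule.span_mono (by rintro _ ⟨i, rfl⟩; exact ⟨_, rfl⟩)

end Descent


/-- The action of the Galois group on the separable closure, as an `𝔽_p`-linear representation. -/
def galRep (p : ℕ) (E Es : Type u) [Field E] [Field Es] [Algebra E Es] [Algebra (ZMod p) Es] :
    Representation (ZMod p) Gal(Es/E) Es where
  toFun g := AddMonoidHom.toZModLinearMap p (g : Es →+* Es).toAddMonoidHom
  map_one' := rfl
  map_mul' _ _ := rfl

theorem expChar_of_algebra_zmod (p : ℕ) [Fact p.Prime] (K : Type u) [Field K]
    [Algebra (ZMod p) K] : ExpChar K p :=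
  have := charP_of_injective_algebraMap (algebraMap (ZMod p) K).injective p
  inferInstance

/-- The Frobenius `σ(x) = x ^ p`, as an `𝔽_p`-linear map. -/
def frobLin (p : ℕ) [Fact p.Prime] (K : Type u) [Field K] [Algebra (ZMod p) K] :
    K →ₗ[ZMod p] K :=
  have := expChar_of_algebra_zmod p K
  AddMonoidHom.toZModLinearMap p (frobenius K p).toAddMonoidHom

theorem frobLin_apply (p : ℕ) [Fact p.Prime] (K : Type u) [Field K] [Algebra (ZMod p) K] (x : K) :
    frobLin p K x = x ^ p := rfl

instance smulCommClass_zmod (p : ℕ) (E Es : Type u) [Field E] [Field Es] [Algebra E Es]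
    [Algebra (ZMod p) Es] : SMulCommClass E (ZMod p) Es :=
  ⟨fun a b x => by simp only [Algebra.smul_def]; ring⟩


variable (p : ℕ) [Fact p.Prime] {E Es : Type u} [Field E] [Field Es] [Algebra E Es]
  [Algebra (ZMod p) Es]


/-- The diagonal action of the Galois group on `E^sep ⊗ V`. -/
def diagAction (V : TopRep.{u} (ZMod p) Gal(Es/E)) :
    Representation (ZMod p) Gal(Es/E) (Es ⊗[ZMod p] V) :=
  (galRep p E Es).tprod V.ρ.toRepresentation

variable {p} (V : TopRep.{u} (ZMod p) Gal(Es/E))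

theorem diagAction_tmul (g : Gal(Es/E)) (a : Es) (v : V) :
    diagAction p V g (a ⊗ₜ v) = g a ⊗ₜ V.ρ g v := rfl

theorem diagAction_smul (g : Gal(Es/E)) (c : Es) (x : Es ⊗[ZMod p] V) :
    diagAction p V g (c • x) = g c • diagAction p V g x := by
  induction x with
  | zero => simp
  | add x y hx hy => simp [hx, hy]
  | tmul a v => simp [diagAction_tmul, TensorProduct.smul_tmul']

/-- The map `σ ⊗ id` on `E^sep ⊗ V`. -/
def frobTensor : Es ⊗[ZMod p] V →ₗ[ZMod p] Es ⊗[ZMod p] V := (frobLin p Es).rTensor V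

theorem frobTensor_tmul (a : Es) (v : V) : frobTensor V (a ⊗ₜ v) = (a ^ p) ⊗ₜ v := rfl

theorem frobTensor_smul (c : Es) (x : Es ⊗[ZMod p] V) :
    frobTensor V (c • x) = (c ^ p) • frobTensor V x := by
  induction x with
  | zero => simp
  | add x y hx hy => simp [hx, hy]
  | tmul a v => simp [frobTensor_tmul, TensorProduct.smul_tmul', mul_pow]

theorem frobTensor_diagAction (g : Gal(Es/E)) (x : Es ⊗[ZMod p] V) :
    frobTensor V (diagAction p V g x) = diagAction p V g (frobTensor V x) := by
  induction x with
  | zero => simp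
  | add x y hx hy => simp [hx, hy]
  | tmul a v => simp [diagAction_tmul, frobTensor_tmul]

theorem smul_eq_algebraMap_smul (c : E) (x : Es ⊗[ZMod p] V) :
    c • x = algebraMap E Es c • x := by
  induction x with
  | zero => simp
  | add x y hx hy => simp only [smul_add, hx, hy]
  | tmul a v => simp [TensorProduct.smul_tmul', Algebra.smul_def]

/-- The `E`-vector space `D(V) = (E^sep ⊗ V)^G`. -/
def fontaineD : Submodule E (Es ⊗[ZMod p] V) where
  carrier := {x | ∀ g, diagAction p V g x = x}
  zero_mem' := by simp
  add_mem' hx hy g := by simp_all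
  smul_mem' c x hx g := by
    rw [smul_eq_algebraMap_smul, diagAction_smul, hx g, AlgEquiv.commutes]

/-- The Frobenius `φ` of `D(V)`, induced by `σ ⊗ id`. -/
def fontainePhi [ExpChar E p] : fontaineD V →ₛₗ[frobenius E p] fontaineD V where
  toFun x := ⟨frobTensor V x.1, fun g => by rw [← frobTensor_diagAction, x.2 g]⟩
  map_add' x y := Subtype.ext (map_add (frobTensor V) x.1 y.1)
  map_smul' c x := Subtype.ext (by
    change frobTensor V (c • x.1) = (c ^ p) • frobTensor V x.1
    rw [smul_eq_algebraMap_smul, frobTensor_smul, smul_eq_algebraMap_smul, map_pow])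

theorem lTensor_diagAction {V W : TopRep.{u} (ZMod p) Gal(Es/E)} (f : V ⟶ W) (g : Gal(Es/E))
    (x : Es ⊗[ZMod p] V) :
    f.hom.toContinuousLinearMap.toLinearMap.lTensor Es (diagAction p V g x) =
      diagAction p W g (f.hom.toContinuousLinearMap.toLinearMap.lTensor Es x) := by
  induction x with
  | zero => simp
  | add x y hx hy => simp [hx, hy]
  | tmul a v => exact congrArg (g a ⊗ₜ[ZMod p] ·) (f.hom.isIntertwining g v)

theorem lTensor_smul {V W : TopRep.{u} (ZMod p) Gal(Es/E)} (f : V ⟶ W) (c : E)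
    (x : Es ⊗[ZMod p] V) :
    f.hom.toContinuousLinearMap.toLinearMap.lTensor Es (c • x) =
      c • f.hom.toContinuousLinearMap.toLinearMap.lTensor Es x := by
  induction x with
  | zero => simp
  | add x y hx hy => simp only [smul_add, map_add, hx, hy]
  | tmul a v => rfl

theorem frobTensor_lTensor {V W : TopRep.{u} (ZMod p) Gal(Es/E)} (f : V ⟶ W)
    (x : Es ⊗[ZMod p] V) :
    f.hom.toContinuousLinearMap.toLinearMap.lTensor Es (frobTensor V x) =
      frobTensor W (f.hom.toContinuousLinearMap.toLinearMap.lTensor Es x) := by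
  induction x with
  | zero => simp
  | add x y hx hy => simp [hx, hy]
  | tmul a v => rfl

/-- The map `D(V) → D(W)` induced by a morphism `V ⟶ W`. -/
def fontaineMap {V W : TopRep.{u} (ZMod p) Gal(Es/E)} (f : V ⟶ W) :
    fontaineD V →ₗ[E] fontaineD W where
  toFun x := ⟨f.hom.toContinuousLinearMap.toLinearMap.lTensor Es x.1, fun g => by
    rw [← lTensor_diagAction, x.2 g]⟩
  map_add' x y := Subtype.ext (map_add (f.hom.toContinuousLinearMap.toLinearMap.lTensor Es) x.1 y.1)
  map_smul' c x := Subtype.ext (lTensor_smul f c x.1)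

theorem span_range_frobTensor : Submodule.span Es (Set.range (frobTensor V)) = ⊤ := by
  rw [eq_top_iff]
  rintro x -
  induction x with
  | zero => exact Submodule.zero_mem _
  | add x y hx hy => exact Submodule.add_mem _ hx hy
  | tmul a v =>
    have h : a ⊗ₜ[ZMod p] v = a • frobTensor V (1 ⊗ₜ[ZMod p] v) := by
      rw [frobTensor_tmul, one_pow, TensorProduct.smul_tmul', smul_eq_mul, mul_one]
    rw [h]
    exact Submodule.smul_mem _ _ (Submodule.subset_span ⟨_, rfl⟩)

theorem finite_fontaineD [IsGalois E Es] [Module.Finite (ZMod p) V] : Module.Finite E (fontaineD V) :=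
  finite_of_fixed (fun g => (diagAction p V g).toAddMonoidHom) (diagAction_smul V) (fontaineD V)
    (fun _ hx => hx)

theorem span_fontainePhi [IsGalois E Es] [ExpChar E p] [Module.Finite (ZMod p) V] :
    Submodule.span E (Set.range (fontainePhi V)) = ⊤ :=
  span_of_fixed (fun g => (diagAction p V g).toAddMonoidHom) (diagAction_smul V) (fontaineD V)
    (fun _ hx => hx) (frobTensor V).toAddMonoidHom (frobTensor_smul V) (span_range_frobTensor V)
    (fontainePhi V) (fun _ => rfl)

variable (p) in
/-- Fontaine's functor `V ↦ D(V) = (E^sep ⊗ V)^G` from mod `p` representations to étale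
`φ`-modules. -/
def fontaineFunctor (E Es : Type u) [Field E] [Field Es] [Algebra E Es] [Algebra (ZMod p) Es]
    [ExpChar E p] [IsGalois E Es] : ModPRep p Gal(Es/E) ⥤ EtalePhiModule p E where
  obj V :=
    have := V.property.2.1
    { carrier := fontaineD V.obj
      finite := finite_fontaineD V.obj
      φ := fontainePhi V.obj
      span_range := span_fontainePhi V.obj }
  map f :=
    { lin := fontaineMap f.hom
      comm := fun x => Subtype.ext (frobTensor_lTensor f.hom x.1) }
  map_id V := EtalePhiModule.hom_ext (LinearMap.ext fun x => Subtype.ext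
    (LinearMap.congr_fun (LinearMap.lTensor_id Es V.obj) x.1))
  map_comp f g := EtalePhiModule.hom_ext (LinearMap.ext fun x => Subtype.ext
    (LinearMap.lTensor_comp_apply Es g.hom.hom.toContinuousLinearMap.toLinearMap
      f.hom.hom.toContinuousLinearMap.toLinearMap x.1))

instance additive_fontaineFunctor (E Es : Type u) [Field E] [Field Es] [Algebra E Es]
    [Algebra (ZMod p) Es] [ExpChar E p] [IsGalois E Es] : (fontaineFunctor p E Es).Additive where
  map_add {_ _ f g} := EtalePhiModule.hom_ext (LinearMap.ext fun x => Subtype.ext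
    (LinearMap.congr_fun (LinearMap.lTensor_add Es f.hom.hom.toContinuousLinearMap.toLinearMap
      g.hom.hom.toContinuousLinearMap.toLinearMap) x.1))

end Fontaine

end

/-! Write `G` for the Galois group. Tensoring the Artin–Schreier sequence `0 → 𝔽_p → E^sep → E^sep →
0`, with second map `x ↦ x ^ p - x`, with `V` gives an equivariant exact sequence `0 → V → E^sep ⊗ V
→ E^sep ⊗ V → 0`. Continuous cochains turn it into a short exact sequence of complexes `0 → C → K →
K → 0`.

By additive Hilbert 90 the complex `K` is acyclic in positive degrees, and `H⁰(K) = D(V)`, on which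
the map `ψ : K → K` induces `φ - 1`. The long exact sequence therefore gives `H⁰(G, V) = ker (φ -
1)`, `H¹(G, V) = coker (φ - 1)` and `Hⁿ(G, V) = 0` for `n ≥ 2`, which is the cohomology of the
complex `B : D(V) → D(V)`.

One trace argument, `exists_fixed_of_semilinear`, yields both the acyclicity (`cochains_acyclic`)
and the surjectivity in the exactness of `D` (`isShortExact_fontaineFunctor`).

For naturality and connecting maps, the isomorphism is defined by its graph, a relation
`FiberComparison.Related` between classes, stated on representing cocycles. `Related.map` and
`Related.δ` then only have to move witnesses along, and no choices need to be compared. In degree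
`1` the relation is minus the connecting map of `0 → C → K → K → 0`. -/

noncomputable section

/-! ### Cohomology classes through representing cocycles. -/

section HomologyClasses

/-- `c` is the class in `Hⁿ(A)` of the cocycle `x`. -/
def IsHomologyClass {A : CochainComplex AddCommGrpCat.{u} ℕ} {n : ℕ} (c : A.homology n)
    (x : A.X n) : Prop :=
  ∃ z : A.cycles n, A.iCycles n z = x ∧ A.homologyπ n z = c

namespace IsHomologyClass

/-- The identity as a forgetful functor from abelian groups to abelian groups. -/
@[reducible]
def hasForgetSelf : HasForget₂ AddCommGrpCat.{u} Ab.{u} where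
  forget₂ := 𝟭 _
  forget_comp := rfl

-- The elementwise tools `cyclesMk` and `δ_apply` are phrased through a functor to `Ab`; here the
-- identity plays that role.
attribute [local instance] hasForgetSelf

instance : (forget₂ AddCommGrpCat.{u} Ab.{u}).Additive :=
  inferInstanceAs (𝟭 AddCommGrpCat.{u}).Additive

instance : (forget₂ AddCommGrpCat.{u} Ab.{u}).PreservesHomology :=
  inferInstanceAs (𝟭 AddCommGrpCat.{u}).PreservesHomology

variable {A B : CochainComplex AddCommGrpCat.{u} ℕ} {n : ℕ}

theorem iCycles_injective (A : CochainComplex AddCommGrpCat.{u} ℕ) (n : ℕ) :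
    Function.Injective (A.iCycles n) :=
  (AddCommGrpCat.mono_iff_injective _).1 inferInstance

theorem d_eq_zero {c : A.homology n} {x : A.X n} (h : IsHomologyClass c x) :
    A.d n (n + 1) x = 0 := by
  obtain ⟨z, rfl, -⟩ := h
  rw [← ConcreteCategory.comp_apply, HomologicalComplex.iCycles_d]
  rfl

theorem exists_of_d_eq_zero {x : A.X n} (h : A.d n (n + 1) x = 0) :
    ∃ c : A.homology n, IsHomologyClass c x :=
  ⟨_, A.cyclesMk (C := AddCommGrpCat.{u}) x (n + 1) (by simp) h,
    A.i_cyclesMk x (n + 1) (by simp) h, rfl⟩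

theorem exists_rep (c : A.homology n) : ∃ x, IsHomologyClass c x := by
  obtain ⟨z, rfl⟩ := (AddCommGrpCat.epi_iff_surjective (A.homologyπ n)).1 inferInstance c
  exact ⟨_, z, rfl, rfl⟩

theorem unique {c c' : A.homology n} {x : A.X n} (h : IsHomologyClass c x)
    (h' : IsHomologyClass c' x) : c = c' := by
  obtain ⟨z, rfl, rfl⟩ := h
  obtain ⟨z', hz, rfl⟩ := h'
  rw [iCycles_injective A n hz]

theorem zero : IsHomologyClass (0 : A.homology n) 0 :=
  ⟨0, map_zero _, map_zero _⟩

theorem add {c c' : A.homology n} {x x' : A.X n} (h : IsHomologyClass c x)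
    (h' : IsHomologyClass c' x') : IsHomologyClass (c + c') (x + x') := by
  obtain ⟨z, rfl, rfl⟩ := h
  obtain ⟨z', rfl, rfl⟩ := h'
  exact ⟨z + z', map_add _ _ _, map_add _ _ _⟩

theorem neg {c : A.homology n} {x : A.X n} (h : IsHomologyClass c x) :
    IsHomologyClass (-c) (-x) := by
  obtain ⟨z, rfl, rfl⟩ := h
  exact ⟨-z, map_neg _ _, map_neg _ _⟩

theorem of_d (y : A.X n) : IsHomologyClass (0 : A.homology (n + 1)) (A.d n (n + 1) y) := by
  refine ⟨A.toCycles n (n + 1) y, ?_, ?_⟩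
  · rw [← ConcreteCategory.comp_apply, HomologicalComplex.toCycles_i]
  · rw [← ConcreteCategory.comp_apply, HomologicalComplex.toCycles_comp_homologyπ]
    rfl

theorem exists_d_eq {x : A.X (n + 1)} (h : IsHomologyClass (0 : A.homology (n + 1)) x) :
    ∃ y, A.d n (n + 1) y = x := by
  obtain ⟨z, rfl, hz⟩ := h
  have he := ShortComplex.exact_of_g_is_cokernel
    (ShortComplex.mk _ _ (A.toCycles_comp_homologyπ n (n + 1)))
    (A.homologyIsCokernel n (n + 1) (by simp))
  obtain ⟨y, hy⟩ := ((ShortComplex.ab_exact_iff_function_exact _).1 he z).1 hz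
  refine ⟨y, ?_⟩
  rw [← hy]
  change _ = A.iCycles (n + 1) (A.toCycles n (n + 1) y)
  rw [← ConcreteCategory.comp_apply, HomologicalComplex.toCycles_i]

/-- There are no coboundaries in degree `0`, so `homologyπ 0` is a monomorphism. -/
theorem eq_zero_of_degree_zero {x : A.X 0} (h : IsHomologyClass (0 : A.homology 0) x) :
    x = 0 := by
  obtain ⟨z, rfl, hz⟩ := h
  have : Function.Injective (A.homologyπ 0) :=
    (AddCommGrpCat.mono_iff_injective _).1 inferInstance
  rw [this (hz.trans (map_zero _).symm), map_zero]

theorem map {c : A.homology n} {x : A.X n} (h : IsHomologyClass c x) (f : A ⟶ B) :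
    IsHomologyClass (HomologicalComplex.homologyMap f n c) (f.f n x) := by
  obtain ⟨z, rfl, rfl⟩ := h
  refine ⟨HomologicalComplex.cyclesMap f n z, ?_, ?_⟩
  · rw [← ConcreteCategory.comp_apply, HomologicalComplex.cyclesMap_i]; rfl
  · rw [← ConcreteCategory.comp_apply, ← HomologicalComplex.homologyπ_naturality]; rfl

/-- The snake lemma on representatives: every choice of cocycle `x₃` and of lift `x₂` is allowed, so
witnesses can be chosen to suit a diagram chase. -/
theorem δ {S : ShortComplex (CochainComplex AddCommGrpCat.{u} ℕ)} (hS : S.ShortExact)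
    {c : S.X₃.homology n} {x₃ : S.X₃.X n} (h : IsHomologyClass c x₃) {x₂ : S.X₂.X n}
    (h₂ : S.g.f n x₂ = x₃) {x₁ : S.X₁.X (n + 1)}
    (h₁ : S.f.f (n + 1) x₁ = S.X₂.d n (n + 1) x₂) :
    IsHomologyClass (hS.δ n (n + 1) rfl c) x₁ := by
  have key := hS.δ_apply n (n + 1) rfl x₃ h.d_eq_zero x₂ h₂ x₁ h₁ (n + 2) (by simp)
  have hc : c = S.X₃.homologyπ n
      (S.X₃.cyclesMk (C := AddCommGrpCat.{u}) x₃ (n + 1) (by simp) h.d_eq_zero) := by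
    refine h.unique ⟨_, S.X₃.i_cyclesMk x₃ (n + 1) (by simp) h.d_eq_zero, rfl⟩
  rw [hc]
  exact ⟨_, S.X₁.i_cyclesMk x₁ (n + 2) (by simp) _, key.symm⟩

end IsHomologyClass

end HomologyClasses

/-! ### Homological algebra: comparing `B` with `C` through `0 → C → K → K → 0`. -/

section Comparison

/-- A short exact sequence `0 ⟶ C ⟶ K ⟶ K ⟶ 0` of complexes of abelian groups in which `K` is
acyclic in positive degrees, and a complex `B` in degrees `0` and `1` whose differential is
the map `ψ : H⁰(K) ⟶ H⁰(K)`. -/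
structure FiberComparison (B C K : CochainComplex AddCommGrpCat.{u} ℕ) where
  i : C ⟶ K
  ψ : K ⟶ K
  i_injective : ∀ n, Function.Injective (i.f n)
  exact : ∀ n, Function.Exact (i.f n) (ψ.f n)
  ψ_surjective : ∀ n, Function.Surjective (ψ.f n)
  acyclic : ∀ n (x : K.X (n + 1)), K.d (n + 1) (n + 2) x = 0 → ∃ y, K.d n (n + 1) y = x
  j₀ : B.X 0 ⟶ K.X 0
  j₁ : B.X 1 ⟶ K.X 0
  j₀_injective : Function.Injective j₀
  j₁_injective : Function.Injective j₁
  j₀_exact : Function.Exact j₀ (K.d 0 1)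
  j₁_exact : Function.Exact j₁ (K.d 0 1)
  ψ_j₀ : ∀ x, ψ.f 0 (j₀ x) = j₁ (B.d 0 1 x)
  subsingleton : ∀ n, Subsingleton (B.X (n + 2))

theorem CochainComplex.hom_d_apply {A B : CochainComplex AddCommGrpCat.{u} ℕ} (f : A ⟶ B) (m n : ℕ)
    (x : A.X m) : f.f n (A.d m n x) = B.d m n (f.f m x) := by
  rw [← ConcreteCategory.comp_apply, ← ConcreteCategory.comp_apply, f.comm]

theorem CochainComplex.d_d_apply (A : CochainComplex AddCommGrpCat.{u} ℕ) (l m n : ℕ)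
    (x : A.X l) : A.d m n (A.d l m x) = 0 := by
  rw [← ConcreteCategory.comp_apply, A.d_comp_d]
  rfl

theorem CochainComplex.g_surjective {S : ShortComplex (CochainComplex AddCommGrpCat.{u} ℕ)}
    (hS : S.ShortExact) (n : ℕ) : Function.Surjective (S.g.f n) :=
  (AddCommGrpCat.epi_iff_surjective _).1 (hS.map_of_exact
    (HomologicalComplex.eval AddCommGrpCat.{u} (ComplexShape.up ℕ) n)).epi_g

theorem CochainComplex.exact_f_g {S : ShortComplex (CochainComplex AddCommGrpCat.{u} ℕ)}
    (hS : S.ShortExact) (n : ℕ) : Function.Exact (S.f.f n) (S.g.f n) :=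
  (ShortComplex.ab_exact_iff_function_exact _).1 (hS.map_of_exact
    (HomologicalComplex.eval AddCommGrpCat.{u} (ComplexShape.up ℕ) n)).exact

theorem CochainComplex.f_injective {S : ShortComplex (CochainComplex AddCommGrpCat.{u} ℕ)}
    (hS : S.ShortExact) (n : ℕ) : Function.Injective (S.f.f n) :=
  (AddCommGrpCat.mono_iff_injective _).1 (hS.map_of_exact
    (HomologicalComplex.eval AddCommGrpCat.{u} (ComplexShape.up ℕ) n)).mono_f

open CochainComplex

namespace FiberComparison

variable {B C K : CochainComplex AddCommGrpCat.{u} ℕ} (F : FiberComparison B C K)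

/-- The correspondence between `Hⁿ(B)` and `Hⁿ(C)`. -/
def Related (n : ℕ) (b : B.homology n) (c : C.homology n) : Prop :=
  match n with
  | 0 => ∃ x y, IsHomologyClass b x ∧ IsHomologyClass c y ∧ F.j₀ x = F.i.f 0 y
  -- Lifting `j₁ x` through `ψ` and applying `d` is the snake construction. The minus sign makes the
  -- isomorphism commute with the maps from degree `0` to degree `1`; without it the square would
  -- anticommute.
  | 1 => ∃ x y o, IsHomologyClass b x ∧ IsHomologyClass c y ∧ F.ψ.f 0 o = F.j₁ x ∧
      F.i.f 1 y = -K.d 0 1 o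
  | _ + 2 => True

theorem related_zero (n : ℕ) : F.Related n 0 0 :=
  match n with
  | 0 => ⟨0, 0, .zero, .zero, by simp⟩
  | 1 => ⟨0, 0, 0, .zero, .zero, by simp, by simp⟩
  | _ + 2 => trivial

theorem Related.add {n : ℕ} {b b' : B.homology n} {c c' : C.homology n} (h : F.Related n b c)
    (h' : F.Related n b' c') : F.Related n (b + b') (c + c') := by
  match n with
  | 0 =>
    obtain ⟨x, y, hx, hy, h⟩ := h
    obtain ⟨x', y', hx', hy', h'⟩ := h'
    exact ⟨_, _, hx.add hx', hy.add hy', by simp only [map_add, h, h']⟩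
  | 1 =>
    obtain ⟨x, y, o, hx, hy, h, k⟩ := h
    obtain ⟨x', y', o', hx', hy', h', k'⟩ := h'
    exact ⟨_, _, o + o', hx.add hx', hy.add hy', by simp only [map_add, h, h'],
      by simp only [map_add, k, k', neg_add]⟩
  | _ + 2 => trivial

theorem Related.neg {n : ℕ} {b : B.homology n} {c : C.homology n} (h : F.Related n b c) :
    F.Related n (-b) (-c) := by
  match n with
  | 0 =>
    obtain ⟨x, y, hx, hy, h⟩ := h
    exact ⟨_, _, hx.neg, hy.neg, by simp only [map_neg, h]⟩
  | 1 =>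
    obtain ⟨x, y, o, hx, hy, h, k⟩ := h
    exact ⟨_, _, -o, hx.neg, hy.neg, by simp only [map_neg, h], by simp only [map_neg, k]⟩
  | _ + 2 => trivial

/-- The graph of the isomorphism between `Hⁿ(B)` and `Hⁿ(C)`. -/
def graph (n : ℕ) : AddSubgroup (B.homology n × C.homology n) where
  carrier := {x | F.Related n x.1 x.2}
  zero_mem' := F.related_zero n
  add_mem' h h' := Related.add F h h'
  neg_mem' h := Related.neg F h

theorem ψ_i (n : ℕ) (y : C.X n) : F.ψ.f n (F.i.f n y) = 0 := (F.exact n _).2 ⟨y, rfl⟩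

theorem d_j₀ (x : B.X 0) : K.d 0 1 (F.j₀ x) = 0 := (F.j₀_exact _).2 ⟨x, rfl⟩

theorem d_j₁ (x : B.X 1) : K.d 0 1 (F.j₁ x) = 0 := (F.j₁_exact _).2 ⟨x, rfl⟩

theorem eq_zero_left (F : FiberComparison B C K) (n : ℕ) (b : B.homology (n + 2)) : b = 0 := by
  obtain ⟨x, hx⟩ := IsHomologyClass.exists_rep b
  have := F.subsingleton n
  rw [Subsingleton.elim x 0] at hx
  exact hx.unique .zero

/-- In the long exact sequence `Hⁿ⁺²(C)` lies between `Hⁿ⁺¹(K)` and `Hⁿ⁺²(K)`, which both vanish. -/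
theorem eq_zero_right (F : FiberComparison B C K) (n : ℕ) (c : C.homology (n + 2)) : c = 0 := by
  obtain ⟨y, hy⟩ := IsHomologyClass.exists_rep c
  obtain ⟨k, hk⟩ := F.acyclic (n + 1) (F.i.f (n + 2) y) (by
    rw [← hom_d_apply, hy.d_eq_zero, map_zero])
  obtain ⟨l, hl⟩ := F.acyclic n (F.ψ.f (n + 1) k) (by rw [← hom_d_apply, hk, F.ψ_i])
  -- Subtracting `d m` from the primitive `k` keeps `d k` and moves `k` into the kernel of `ψ`, that
  -- is, into `C`.
  obtain ⟨m, rfl⟩ := F.ψ_surjective n l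
  obtain ⟨z, hz⟩ := (F.exact (n + 1) (k - K.d n (n + 1) m)).1 (by
    rw [map_sub, hom_d_apply, hl, sub_self])
  have hy' : y = C.d (n + 1) (n + 2) z := F.i_injective _ (by
    rw [hom_d_apply, hz, map_sub, d_d_apply, sub_zero, hk])
  rw [hy'] at hy
  exact hy.unique (.of_d z)

/-- In degree `0`, a cocycle of `B` is killed by `ψ` inside `K` and hence comes from `C`. In degree
`1`, surjectivity of `ψ` supplies `o`, and `d o` comes from `C` because `j₁ x` is a cocycle. -/
theorem Related.exists_right {n : ℕ} (b : B.homology n) : ∃ c, F.Related n b c := by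
  match n with
  | 0 =>
    obtain ⟨x, hx⟩ := IsHomologyClass.exists_rep b
    obtain ⟨y, hy⟩ := (F.exact 0 (F.j₀ x)).1 (by rw [F.ψ_j₀, hx.d_eq_zero, map_zero])
    obtain ⟨c, hc⟩ := IsHomologyClass.exists_of_d_eq_zero (x := y) (F.i_injective _ (by
      rw [hom_d_apply, hy, F.d_j₀, map_zero]))
    exact ⟨c, x, y, hx, hc, hy.symm⟩
  | 1 =>
    obtain ⟨x, hx⟩ := IsHomologyClass.exists_rep b
    obtain ⟨o, ho⟩ := F.ψ_surjective 0 (F.j₁ x)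
    obtain ⟨y, hy⟩ := (F.exact 1 (-K.d 0 1 o)).1 (by
      rw [map_neg, hom_d_apply, ho, F.d_j₁, neg_zero])
    obtain ⟨c, hc⟩ := IsHomologyClass.exists_of_d_eq_zero (x := y) (F.i_injective _ (by
      rw [hom_d_apply, hy, map_neg, d_d_apply, map_zero, neg_zero]))
    exact ⟨c, x, y, o, hx, hc, ho, hy⟩
  | _ + 2 => exact ⟨0, trivial⟩

/-- The degree `1` case rests on `H¹(K) = 0`: it provides `o` with `d o = -i y`, and then `ψ o` is a
`0`-cocycle of `K`, so it lies in the image of `j₁`. -/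
theorem Related.exists_left {n : ℕ} (c : C.homology n) : ∃ b, F.Related n b c := by
  match n with
  | 0 =>
    obtain ⟨y, hy⟩ := IsHomologyClass.exists_rep c
    obtain ⟨x, hx⟩ := (F.j₀_exact (F.i.f 0 y)).1 (by rw [← hom_d_apply, hy.d_eq_zero, map_zero])
    obtain ⟨b, hb⟩ := IsHomologyClass.exists_of_d_eq_zero (x := x) (F.j₁_injective (by
      rw [← F.ψ_j₀, hx, F.ψ_i, map_zero]))
    exact ⟨b, x, y, hb, hy, hx⟩
  | 1 =>
    obtain ⟨y, hy⟩ := IsHomologyClass.exists_rep c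
    obtain ⟨o, ho⟩ := F.acyclic 0 (-F.i.f 1 y) (by
      rw [map_neg, ← hom_d_apply, hy.d_eq_zero, map_zero, neg_zero])
    obtain ⟨x, hx⟩ := (F.j₁_exact (F.ψ.f 0 o)).1 (by
      rw [← hom_d_apply, ho, map_neg, F.ψ_i, neg_zero])
    have := F.subsingleton 0
    obtain ⟨b, hb⟩ := IsHomologyClass.exists_of_d_eq_zero (x := x) (Subsingleton.elim _ _)
    exact ⟨b, x, y, o, hb, hy, hx.symm, by rw [ho, neg_neg]⟩
  | _ + 2 => exact ⟨0, trivial⟩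

/-- In degree `1`, if `x = d x'`, then `o - j₀ x'` lies in `ker ψ = C`, and minus this element is a
primitive of `y`. -/
theorem Related.eq_zero_right {n : ℕ} {c : C.homology n} (h : F.Related n 0 c) : c = 0 := by
  match n with
  | 0 =>
    obtain ⟨x, y, hx, hy, h⟩ := h
    rw [hx.eq_zero_of_degree_zero, map_zero] at h
    rw [F.i_injective 0 (h.symm.trans (map_zero _).symm)] at hy
    exact hy.unique .zero
  | 1 =>
    obtain ⟨x, y, o, hx, hy, h, h'⟩ := h
    obtain ⟨x', rfl⟩ := hx.exists_d_eq
    obtain ⟨z, hz⟩ := (F.exact 0 (o - F.j₀ x')).1 (by rw [map_sub, h, F.ψ_j₀, sub_self])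
    have hy' : y = C.d 0 1 (-z) := F.i_injective _ (by
      rw [hom_d_apply, map_neg, hz, map_neg, map_sub, F.d_j₀, sub_zero, h'])
    rw [hy'] at hy
    exact hy.unique (.of_d _)
  | n + 2 => exact F.eq_zero_right n c

/-- In degree `1`, if `y = d z`, then `o + i z` is a `0`-cocycle of `K`. It comes from some `x'` in
`B`, and applying `ψ` shows `x = d x'`. -/
theorem Related.eq_zero_left {n : ℕ} {b : B.homology n} (h : F.Related n b 0) : b = 0 := by
  match n with
  | 0 =>
    obtain ⟨x, y, hx, hy, h⟩ := h
    rw [hy.eq_zero_of_degree_zero, map_zero] at h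
    rw [F.j₀_injective (h.trans (map_zero _).symm)] at hx
    exact hx.unique .zero
  | 1 =>
    obtain ⟨x, y, o, hx, hy, h, h'⟩ := h
    obtain ⟨z, rfl⟩ := hy.exists_d_eq
    obtain ⟨x', hx'⟩ := (F.j₀_exact (o + F.i.f 0 z)).1 (by
      rw [map_add, ← hom_d_apply, h', add_neg_cancel])
    have hx'' : x = B.d 0 1 x' := F.j₁_injective (by
      rw [← F.ψ_j₀, hx', map_add, F.ψ_i, add_zero, h])
    rw [hx''] at hx
    exact hx.unique (.of_d _)
  | n + 2 => exact F.eq_zero_left n b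

/-- The graph is a subgroup, so injectivity of a projection only concerns classes related to `0`.
Together with `bijective_snd` this makes it the graph of an additive isomorphism. -/
theorem bijective_fst (n : ℕ) : Function.Bijective (Prod.fst ∘ (F.graph n).subtype) := by
  refine ⟨(injective_iff_map_eq_zero
    ((AddMonoidHom.fst _ _).comp (F.graph n).subtype)).2 ?_, fun b => ?_⟩
  · rintro ⟨⟨b, c⟩, h⟩ (rfl : b = 0)
    exact Subtype.ext (Prod.ext rfl (Related.eq_zero_right F h))
  · obtain ⟨c, h⟩ := Related.exists_right F b
    exact ⟨⟨(b, c), h⟩, rfl⟩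

theorem bijective_snd (n : ℕ) : Function.Bijective (Prod.snd ∘ (F.graph n).subtype) := by
  refine ⟨(injective_iff_map_eq_zero
    ((AddMonoidHom.snd _ _).comp (F.graph n).subtype)).2 ?_, fun c => ?_⟩
  · rintro ⟨⟨b, c⟩, h⟩ (rfl : c = 0)
    exact Subtype.ext (Prod.ext (Related.eq_zero_left F h) rfl)
  · obtain ⟨b, h⟩ := Related.exists_left F c
    exact ⟨⟨(b, c), h⟩, rfl⟩

/-- The isomorphism between `Hⁿ(B)` and `Hⁿ(C)`. -/
def homologyEquiv (n : ℕ) : B.homology n ≃+ C.homology n :=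
  (AddSubgroup.exists_addEquiv_eq_graph (F.bijective_fst n) (F.bijective_snd n)).choose

theorem related_iff {n : ℕ} {b : B.homology n} {c : C.homology n} :
    F.Related n b c ↔ F.homologyEquiv n b = c := by
  have h := (AddSubgroup.exists_addEquiv_eq_graph (F.bijective_fst n)
    (F.bijective_snd n)).choose_spec
  exact SetLike.ext_iff.1 h (b, c)

variable {B' C' K' : CochainComplex AddCommGrpCat.{u} ℕ} {F} {F' : FiberComparison B' C' K'}

/-- All witnesses are carried along by `β`, `γ`, `κ`; this is the naturality of the comparison. -/
theorem Related.map {n : ℕ} {b : B.homology n} {c : C.homology n} (h : F.Related n b c)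
    (β : B ⟶ B') (γ : C ⟶ C') (κ : K ⟶ K') (hi : F.i ≫ κ = γ ≫ F'.i) (hψ : F.ψ ≫ κ = κ ≫ F'.ψ)
    (h₀ : F.j₀ ≫ κ.f 0 = β.f 0 ≫ F'.j₀) (h₁ : F.j₁ ≫ κ.f 0 = β.f 1 ≫ F'.j₁) :
    F'.Related n (HomologicalComplex.homologyMap β n b)
      (HomologicalComplex.homologyMap γ n c) := by
  have hi' (n) (y : C.X n) : F'.i.f n (γ.f n y) = κ.f n (F.i.f n y) :=
    (ConcreteCategory.congr_hom (HomologicalComplex.congr_hom hi n) y).symm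
  have hψ' (n) (y : K.X n) : F'.ψ.f n (κ.f n y) = κ.f n (F.ψ.f n y) :=
    (ConcreteCategory.congr_hom (HomologicalComplex.congr_hom hψ n) y).symm
  have h₀' (x) : F'.j₀ (β.f 0 x) = κ.f 0 (F.j₀ x) := (ConcreteCategory.congr_hom h₀ x).symm
  have h₁' (x) : F'.j₁ (β.f 1 x) = κ.f 0 (F.j₁ x) := (ConcreteCategory.congr_hom h₁ x).symm
  match n with
  | 0 =>
    obtain ⟨x, y, hx, hy, h⟩ := h
    exact ⟨_, _, hx.map β, hy.map γ, by rw [h₀', hi', h]⟩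
  | 1 =>
    obtain ⟨x, y, o, hx, hy, h, h'⟩ := h
    exact ⟨_, _, κ.f 0 o, hx.map β, hy.map γ, by rw [hψ', h, h₁'],
      by rw [hi', h', map_neg, hom_d_apply]⟩
  | _ + 2 => trivial

/-- The isomorphisms are compatible with connecting homomorphisms. -/
theorem Related.δ {SB SC : ShortComplex (CochainComplex AddCommGrpCat.{u} ℕ)}
    {K₁ K₂ K₃ : CochainComplex AddCommGrpCat.{u} ℕ} {κ : K₁ ⟶ K₂} {κ' : K₂ ⟶ K₃}
    (hSB : SB.ShortExact) (hSC : SC.ShortExact)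
    (hκ : ∀ n, Function.Injective (κ.f n)) (hκκ' : Function.Exact (κ.f 0) (κ'.f 0))
    {F₁ : FiberComparison SB.X₁ SC.X₁ K₁} {F₂ : FiberComparison SB.X₂ SC.X₂ K₂}
    {F₃ : FiberComparison SB.X₃ SC.X₃ K₃}
    (hi : F₁.i ≫ κ = SC.f ≫ F₂.i) (hi' : F₂.i ≫ κ' = SC.g ≫ F₃.i)
    (hψ : F₁.ψ ≫ κ = κ ≫ F₂.ψ)
    (h₀ : F₂.j₀ ≫ κ'.f 0 = SB.g.f 0 ≫ F₃.j₀) (h₁ : F₁.j₁ ≫ κ.f 0 = SB.f.f 1 ≫ F₂.j₁)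
    {n : ℕ} {b : SB.X₃.homology n} {c : SC.X₃.homology n} (h : F₃.Related n b c) :
    F₁.Related (n + 1) (hSB.δ n (n + 1) rfl b) (hSC.δ n (n + 1) rfl c) := by
  match n with
  | 0 =>
    obtain ⟨x₃, y₃, hx, hy, h⟩ := h
    obtain ⟨x₂, hx₂⟩ := g_surjective hSB 0 x₃
    obtain ⟨y₂, hy₂⟩ := g_surjective hSC 0 y₃
    obtain ⟨x₁, hx₁⟩ := (exact_f_g hSB 1 (SB.X₂.d 0 1 x₂)).1 (by
      rw [hom_d_apply, hx₂, hx.d_eq_zero])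
    obtain ⟨y₁, hy₁⟩ := (exact_f_g hSC 1 (SC.X₂.d 0 1 y₂)).1 (by
      rw [hom_d_apply, hy₂, hy.d_eq_zero])
    have ei (n) (y) : κ.f n (F₁.i.f n y) = F₂.i.f n (SC.f.f n y) :=
      ConcreteCategory.congr_hom (HomologicalComplex.congr_hom hi n) y
    have ei' (n) (y) : κ'.f n (F₂.i.f n y) = F₃.i.f n (SC.g.f n y) :=
      ConcreteCategory.congr_hom (HomologicalComplex.congr_hom hi' n) y
    have eψ (n) (y) : κ.f n (F₁.ψ.f n y) = F₂.ψ.f n (κ.f n y) :=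
      ConcreteCategory.congr_hom (HomologicalComplex.congr_hom hψ n) y
    have e₀ (x) : κ'.f 0 (F₂.j₀ x) = F₃.j₀ (SB.g.f 0 x) := ConcreteCategory.congr_hom h₀ x
    have e₁ (x) : κ.f 0 (F₁.j₁ x) = F₂.j₁ (SB.f.f 1 x) := ConcreteCategory.congr_hom h₁ x
    -- The lifts `x₂` and `y₂` need not agree in `K₂`, but their difference dies in `K₃`. Its
    -- preimage `o` in `K₁` is exactly the witness that degree `1` asks for: `ψ` sees only the part
    -- from `x₂`, and `d` only the part from `y₂`.
    obtain ⟨o, ho⟩ := (hκκ' (F₂.j₀ x₂ - F₂.i.f 0 y₂)).1 (by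
      rw [map_sub, e₀, ei', hx₂, hy₂, h, sub_self])
    refine ⟨x₁, y₁, o, hx.δ hSB hx₂ hx₁, hy.δ hSC hy₂ hy₁, hκ 0 ?_, hκ 1 ?_⟩
    · rw [eψ, ho, map_sub, F₂.ψ_i, sub_zero, F₂.ψ_j₀, e₁, hx₁]
    · rw [ei, hy₁, map_neg, hom_d_apply, hom_d_apply, ho, map_sub, F₂.d_j₀, zero_sub, neg_neg]
  -- The target degree is at least `2`, where both groups vanish.
  | _ + 1 => trivial

end FiberComparison

end Comparison

/-! ### Additive Hilbert 90 by the trace. -/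

section AdditiveHilbert90

/-- If an equivariant and `E^sep`-linear map between groups with semilinear Galois actions takes
a vector with open stabilizer to a fixed vector, then it takes some fixed vector to it. -/
theorem exists_fixed_of_semilinear {E Es A B : Type*} [Field E] [Field Es] [Algebra E Es]
    [IsGalois E Es] [AddCommGroup A] [AddCommGroup B] (a : Gal(Es/E) → A →+ A)
    (ha : ∀ g h x, a (g * h) x = a g (a h x)) (b : Gal(Es/E) → B →+ B)
    (m : Es →+ A →+ A) (hm : ∀ g c x, a g (m c x) = m (g c) (a g x))
    (m' : Es →+ B →+ B) (hm' : ∀ g c x, b g (m' c x) = m' (g c) (b g x)) (hm1 : ∀ x, m' 1 x = x)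
    (f : A →+ B) (hf : ∀ g x, f (a g x) = b g (f x)) (hfm : ∀ c x, f (m c x) = m' c (f x))
    (y : A) (hy : IsOpen {g | a g y = y}) (hy1 : a 1 y = y) (hfy : ∀ g, b g (f y) = f y) :
    ∃ z, (∀ g, a g z = z) ∧ f z = f y := by
  obtain ⟨L, hL⟩ := (InfiniteGalois.krullTopology_mem_nhds_one_iff_of_isGalois _).1 (hy.mem_nhds hy1)
  -- `L` is a finite Galois extension whose fixing subgroup stabilizes `y`; by separability it has
  -- an element `t` of trace `1`.
  obtain ⟨t, ht⟩ := Algebra.trace_surjective E L 1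
  have hsurj := AlgEquiv.restrictNormalHom_surjective (F := E) (K₁ := L) Es
  choose s hs using hsurj
  have hsa (σ) : s σ (t : Es) = (σ t : L) := by
    exact (AlgEquiv.restrictNormal_commutes (s σ) L t).symm.trans
      (congrArg (fun τ : Gal(L/E) => ((τ t : L) : Es)) (hs σ))
  -- `t` and `y` are both fixed by the fixing subgroup of `L`, so the translate of `t y` by `g`
  -- depends only on `g` restricted to `L`. The set-theoretic lifts `s σ` thus serve as well as a
  -- homomorphic section.
  have key (g h) (hgh : AlgEquiv.restrictNormalHom L g = AlgEquiv.restrictNormalHom L h) :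
      a g (m t y) = a h (m t y) := by
    have hk : h⁻¹ * g ∈ L.fixingSubgroup := by
      rw [← IntermediateField.restrictNormalHom_ker, MonoidHom.mem_ker, map_mul, map_inv,
        hgh, inv_mul_cancel]
    have h₁ : a (h⁻¹ * g) y = y := hL hk
    have h₂ : (h⁻¹ * g) (t : Es) = t := hk t
    rw [← mul_inv_cancel_left h g, ha, hm (h⁻¹ * g), h₁, h₂]
  -- The witness is the trace of `t y` over `Gal(L/E)`. As `f y` is fixed, its image is `(∑ σ t) f y
  -- = f y`.
  refine ⟨∑ σ, a (s σ) (m t y), fun g => ?_, ?_⟩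
  · rw [map_sum]
    refine Fintype.sum_equiv (Equiv.mulLeft (AlgEquiv.restrictNormalHom L g)) _ _ fun σ => ?_
    rw [← ha]
    refine key _ _ ?_
    rw [map_mul, hs, hs]
    rfl
  · simp only [map_sum, hf, hfm, hm', hfy, hsa]
    rw [← AddMonoidHom.finsetSum_apply, ← map_sum]
    have h := trace_eq_sum_automorphisms (K := E) t
    rw [ht, map_one] at h
    have h' := congrArg (algebraMap L Es) h
    rw [map_one, map_sum] at h'
    exact (congrArg (fun c => m' c (f y)) h').symm.trans (hm1 _)

end AdditiveHilbert90

/-! ### The standard resolution: discreteness and scalar multiplication. -/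

section Resolution

/-- A continuous `f` has finite range, and it is determined by the finitely many conditions that
each compact fibre `f ⁻¹' {y}` be sent to `y`; each is open in the compact-open topology. -/
theorem ContinuousMap.discreteTopology {X Y : Type*} [TopologicalSpace X] [CompactSpace X]
    [TopologicalSpace Y] [DiscreteTopology Y] : DiscreteTopology C(X, Y) := by
  refine discreteTopology_iff_isOpen_singleton.2 fun f => ?_
  have hfin : (Set.range f).Finite := (isCompact_range f.continuous).finite_of_discrete
  have h : {f} = ⋂ y ∈ Set.range f, {g : C(X, Y) | Set.MapsTo g (f ⁻¹' {y}) {y}} := by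
    ext g
    simp only [Set.mem_singleton_iff, Set.mem_iInter, Set.mem_ofPred_eq]
    refine ⟨?_, fun h => ContinuousMap.ext fun x => h (f x) ⟨x, rfl⟩ rfl⟩
    rintro rfl y -
    exact fun x hx => hx
  rw [h]
  exact hfin.isOpen_biInter fun y _ => ContinuousMap.isOpen_setOfPred_mapsTo
    ((isClosed_discrete _).preimage f.continuous).isCompact (isOpen_discrete _)

open TopRep

variable {p : ℕ} {G : Type u} [Group G] [TopologicalSpace G] [IsTopologicalGroup G]

/-- By this recursion, evaluation at a point contracts the resolution, though not equivariantly: `d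
F = 0` forces `F = d (F t)`. -/
theorem TopRep.d_succ_apply {X : TopRep.{u} (ZMod p) G} (n : ℕ) (F : C(G, resolutionX X n)) (t : G) :
    ((d X (n + 1)).hom F : C(G, resolutionX X (n + 1))) t = F - (d X n).hom (F t) := rfl

theorem discreteTopology_resolutionX [CompactSpace G] (X : TopRep.{u} (ZMod p) G)
    [DiscreteTopology X] (n : ℕ) : DiscreteTopology (resolutionX X n) := by
  induction n with
  | zero => assumption
  | succ n ih => exact ContinuousMap.discreteTopology

/-- An additive family of endomorphisms of `X` acts on continuous functions with values in `X`. -/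
def ContinuousMap.endFamily {R T X : Type*} [AddCommGroup R] [TopologicalSpace T]
    [TopologicalSpace X] [AddCommGroup X] [IsTopologicalAddGroup X] [DiscreteTopology X]
    (m : R →+ X →+ X) : R →+ C(T, X) →+ C(T, X) :=
  AddMonoidHom.mk' (fun c => AddMonoidHom.mk'
    (fun F => ⟨fun x => m c (F x), continuous_of_discreteTopology.comp F.continuous⟩)
    (fun F F' => ContinuousMap.ext fun x => map_add (m c) (F x) (F' x)))
    (fun c c' => AddMonoidHom.ext fun F => ContinuousMap.ext fun x => by simp)

/-- The extension of an additive family of endomorphisms to the standard resolution. -/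
def resolutionEnd [CompactSpace G] {R : Type*} [AddCommGroup R] (X : TopRep.{u} (ZMod p) G)
    [DiscreteTopology X] (m : R →+ X →+ X) :
    ∀ n, R →+ resolutionX X n →+ resolutionX X n
  | 0 => m
  | n + 1 =>
    have := discreteTopology_resolutionX X n
    ContinuousMap.endFamily (resolutionEnd X m n)

variable [CompactSpace G] {R : Type*} [AddCommGroup R] {X : TopRep.{u} (ZMod p) G}
    [DiscreteTopology X] {m : R →+ X →+ X}

theorem resolutionEnd_succ_apply (n : ℕ) (c : R) (F : C(G, resolutionX X n)) (x : G) :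
    (resolutionEnd X m (n + 1) c F : C(G, resolutionX X n)) x = resolutionEnd X m n c (F x) := rfl

theorem resolutionEnd_ρ (α : G → R → R)
    (hm : ∀ g c x, X.ρ g (m c x) = m (α g c) (X.ρ g x)) (n : ℕ) (g : G) (c : R)
    (x : resolutionX X n) :
    (resolutionX X n).ρ g (resolutionEnd X m n c x) =
      resolutionEnd X m n (α g c) ((resolutionX X n).ρ g x) := by
  induction n with
  | zero => exact hm g c x
  | succ n ih => exact ContinuousMap.ext fun t => ih _

theorem resolutionEnd_one {c : R} (hm : ∀ x, m c x = x) (n : ℕ) (x : resolutionX X n) :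
    resolutionEnd X m n c x = x := by
  induction n with
  | zero => exact hm x
  | succ n ih => exact ContinuousMap.ext fun t => ih _

theorem d_resolutionEnd (n : ℕ) (c : R) (x : resolutionX X n) :
    (d X n).hom (resolutionEnd X m n c x) = resolutionEnd X m (n + 1) c ((d X n).hom x) := by
  induction n with
  | zero => rfl
  | succ n ih =>
    refine ContinuousMap.ext fun t => ?_
    rw [resolutionEnd_succ_apply, d_succ_apply, d_succ_apply, map_sub, ← ih]
    rfl

end Resolution

/-! ### Homogeneous cochains as invariants of the resolution. -/

section Cochains

open TopRep ModPRep

variable {p : ℕ} {G : Type u} [Group G] [TopologicalSpace G] [IsTopologicalGroup G]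
  {X Y : TopRep.{u} (ZMod p) G}

/-- The function underlying a homogeneous cochain. -/
def cochainVal {n : ℕ} (x : ((cochains p G).obj X).X n) : resolutionX X (n + 1) :=
  (show (homogeneousCochains X).X n from x).1

/-- The homogeneous cochain with a given underlying function. -/
def cochainMk {n : ℕ} (F : resolutionX X (n + 1)) (hF : ∀ g, (resolutionX X (n + 1)).ρ g F = F) :
    ((cochains p G).obj X).X n :=
  show (homogeneousCochains X).X n from ⟨F, hF⟩

theorem ρ_cochainVal {n : ℕ} (x : ((cochains p G).obj X).X n) (g : G) :
    (resolutionX X (n + 1)).ρ g (cochainVal x) = cochainVal x :=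
  (show (homogeneousCochains X).X n from x).2 g

theorem cochainVal_injective {n : ℕ} :
    Function.Injective (cochainVal : ((cochains p G).obj X).X n → _) :=
  fun _ _ h => Subtype.ext h

theorem cochainVal_zero {n : ℕ} : cochainVal (0 : ((cochains p G).obj X).X n) = 0 := rfl

theorem cochainVal_d {n : ℕ} (x : ((cochains p G).obj X).X n) :
    cochainVal (((cochains p G).obj X).d n (n + 1) x) = (d X (n + 1)).hom (cochainVal x) :=
  homogeneousCochains.d_apply X n x

/-- A cocycle is the differential of each of its values. In degree `0`, where `d X 0` forms constant
functions, this says that it is constant. -/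
theorem d_cochain_eq_zero_iff {n : ℕ} {x : ((cochains p G).obj X).X n} :
    ((cochains p G).obj X).d n (n + 1) x = 0 ↔
      ∀ t, cochainVal x = (d X n).hom ((cochainVal x : C(G, resolutionX X n)) t) := by
  rw [← cochainVal_injective.eq_iff, cochainVal_zero, cochainVal_d]
  constructor
  · intro h t
    exact sub_eq_zero.1 (DFunLike.congr_fun h t)
  · intro h
    exact ContinuousMap.ext fun t => sub_eq_zero.2 (h t)

end Cochains

/-! ### Acyclicity of discrete semilinear representations. -/

section Acyclic

open TopRep ModPRep

variable {p : ℕ} {E Es : Type u} [Field E] [Field Es] [Algebra E Es] [IsGalois E Es]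

/-- Discrete semilinear representations of the Galois group are acyclic. -/
theorem cochains_acyclic (X : TopRep.{u} (ZMod p) Gal(Es/E)) [DiscreteTopology X]
    (hX : Continuous (fun x : Gal(Es/E) × X => X.ρ x.1 x.2)) (m : Es →+ X →+ X)
    (hm : ∀ g c x, X.ρ g (m c x) = m (g c) (X.ρ g x)) (hm1 : ∀ x, m 1 x = x) (n : ℕ)
    (x : ((cochains p Gal(Es/E)).obj X).X (n + 1))
    (hx : ((cochains p Gal(Es/E)).obj X).d (n + 1) (n + 2) x = 0) :
    ∃ y, ((cochains p Gal(Es/E)).obj X).d n (n + 1) y = x := by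
  rw [d_cochain_eq_zero_iff] at hx
  have := discreteTopology_resolutionX X (n + 1)
  -- The cocycle is `d (x 1)`. The value `x 1` need not be invariant, but its differential `x` is,
  -- and discreteness gives `x 1` an open stabilizer; so the trace argument, with pointwise scalars
  -- on the resolution, replaces it by an invariant primitive.
  obtain ⟨z, hz, hz'⟩ := exists_fixed_of_semilinear
    (fun g => (((resolutionX X (n + 1)).ρ g).toLinearMap.toAddMonoidHom))
    (fun g h x => by
      change (resolutionX X (n + 1)).ρ (g * h) x = _
      rw [map_mul]; rfl)
    (fun g => (((resolutionX X (n + 2)).ρ g).toLinearMap.toAddMonoidHom))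
    (resolutionEnd X m (n + 1)) (resolutionEnd_ρ (fun (g : Gal(Es/E)) c => g c) hm (n + 1))
    (resolutionEnd X m (n + 2)) (resolutionEnd_ρ (fun (g : Gal(Es/E)) c => g c) hm (n + 2))
    (resolutionEnd_one hm1 _) ((d X (n + 1)).hom.toContinuousLinearMap.toLinearMap.toAddMonoidHom)
    (fun g x => (d X (n + 1)).hom.isIntertwining g x) (d_resolutionEnd (n + 1))
    ((cochainVal x : C(Gal(Es/E), resolutionX X (n + 1))) 1)
    ((isOpen_discrete {_}).preimage ((continuous_resolutionX hX (n + 1)).comp (.prodMk_left _)))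
    (by
      change (resolutionX X (n + 1)).ρ 1 _ = _
      rw [map_one]; rfl)
    (fun g => by
      change (resolutionX X (n + 2)).ρ g ((d X (n + 1)).hom _) = (d X (n + 1)).hom _
      rw [← hx 1, ρ_cochainVal])
  refine ⟨cochainMk z hz, cochainVal_injective ?_⟩
  rw [cochainVal_d, hx 1]
  exact hz'

end Acyclic

/-! ### Exactness of cochains for discrete coefficients, not necessarily finite ones such as `E^sep
⊗ V`. -/

section ShortExactCochains

open TopRep

variable {p : ℕ} {G : Type u} [Group G] [TopologicalSpace G] [IsTopologicalGroup G]

/-- Short exact sequences of discrete representations induce short exact sequences of continuous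
homogeneous cochains. -/
theorem shortExact_map_cochains [LocallyCompactSpace G] (S : ShortComplex (TopRep.{u} (ZMod p) G))
    [DiscreteTopology S.X₁] [DiscreteTopology S.X₂] [DiscreteTopology S.X₃]
    (hc : Continuous (fun x : G × S.X₂ => S.X₂.ρ x.1 x.2)) (h₁ : Function.Injective S.f.hom)
    (h₂ : Function.Exact S.f.hom S.g.hom) (h₃ : Function.Surjective S.g.hom) :
    (S.map (ModPRep.cochains p G)).ShortExact := by
  have hf : Topology.IsEmbedding S.f.hom :=
    (Topology.IsClosedEmbedding.of_continuous_injective_isClosedMap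
      continuous_of_discreteTopology h₁ fun _ _ => isClosed_discrete _).isEmbedding
  have hg : ∃ s : C(S.X₃, S.X₂), ∀ z, S.g.hom (s z) = z :=
    ⟨⟨Function.surjInv h₃, continuous_of_discreteTopology⟩, Function.surjInv_eq h₃⟩
  refine HomologicalComplex.shortExact_of_degreewise_shortExact _ fun n => ?_
  have hfi := (ModPRep.isEmbedding_resMap S.f hf (n + 1)).injective
  have hfg := ModPRep.exact_resMap S.f S.g hf h₂ (n + 1)
  refine
    { exact := (ShortComplex.ab_exact_iff_function_exact _).2 ?_
      mono_f := (AddCommGrpCat.mono_iff_injective _).2 ?_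
      epi_g := (AddCommGrpCat.epi_iff_surjective _).2 ?_ }
  · rintro ⟨F, hF⟩
    constructor
    · intro h
      obtain ⟨k, hk⟩ := (hfg F).1 (congrArg Subtype.val h)
      refine ⟨⟨k, fun x => hfi ?_⟩, Subtype.ext hk⟩
      have := (ModPRep.resMap S.f (n + 1)).hom.isIntertwining x k
      rw [hk] at this
      exact this.trans ((hF x).trans hk.symm)
    · rintro ⟨k, hk⟩
      exact Subtype.ext ((hfg F).2 ⟨k.1, congrArg Subtype.val hk⟩)
  · exact fun a b h => Subtype.ext (hfi (congrArg Subtype.val h))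
  · rintro ⟨F, hF⟩
    obtain ⟨s, hs⟩ := ModPRep.exists_section_resMap S.g hg n
    have hc := ModPRep.continuous_resolutionX hc n
    -- A homogeneous cochain is determined by its value at `1`. Only that value is lifted, by a
    -- section that need not be equivariant; the action spreads it to an invariant function `H`.
    let a := s ((F : C(G, resolutionX S.X₃ n)) 1)
    let H : C(G, resolutionX S.X₂ n) :=
      ⟨fun x => (resolutionX S.X₂ n).ρ x a, hc.comp (.prodMk_left a)⟩
    refine ⟨⟨H, fun x => ContinuousMap.ext fun y => ?_⟩, Subtype.ext (ContinuousMap.ext fun y => ?_)⟩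
    · change (resolutionX S.X₂ n).ρ x ((resolutionX S.X₂ n).ρ (x⁻¹ * y) a) =
        (resolutionX S.X₂ n).ρ y a
      rw [← mul_apply_eq_comp, ← map_mul, mul_inv_cancel_left]
    · change (ModPRep.resMap S.g n).hom ((resolutionX S.X₂ n).ρ y a) =
        (F : C(G, resolutionX S.X₃ n)) y
      have h₄ := (ModPRep.resMap S.g n).hom.isIntertwining y a
      have h₅ : (resolutionX S.X₃ n).ρ y ((F : C(G, resolutionX S.X₃ n)) (y⁻¹ * y)) =
        (F : C(G, resolutionX S.X₃ n)) y := DFunLike.congr_fun (hF y) y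
      rw [inv_mul_cancel] at h₅
      exact h₄.trans ((congrArg _ (hs _)).trans h₅)

end ShortExactCochains

/-! ### The Artin–Schreier sequence, tensored with `V`. -/

section ArtinSchreier

variable (p : ℕ) [Fact p.Prime] (K : Type u) [Field K] [Algebra (ZMod p) K]

theorem charP_of_algebra_zmod : CharP K p :=
  charP_of_injective_algebraMap (algebraMap (ZMod p) K).injective p

/-- The Artin–Schreier map `x ↦ x ^ p - x`. -/
def artinSchreier : K →ₗ[ZMod p] K := frobLin p K - LinearMap.id

theorem artinSchreier_apply (x : K) : artinSchreier p K x = x ^ p - x := rfl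

/-- `X ^ p - X - c` has derivative `-1` in characteristic `p`, so it is separable and has a root. -/
theorem artinSchreier_surjective [IsSepClosed K] : Function.Surjective (artinSchreier p K) := by
  intro c
  have := charP_of_algebra_zmod p K
  obtain ⟨x, hx⟩ := IsSepClosed.exists_root_C_mul_X_pow_add_C_mul_X_add_C' p p (1 : K) (-1) (-c)
    dvd_rfl (Fact.out : p.Prime).two_le (by simp)
  refine ⟨x, ?_⟩
  rw [artinSchreier_apply]
  linear_combination hx

/-- The solutions of `x ^ p = x` form the prime subfield, which is the image of `ZMod p`. -/
theorem exact_artinSchreier :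
    Function.Exact (Algebra.linearMap (ZMod p) K) (artinSchreier p K) := by
  intro x
  have := charP_of_algebra_zmod p K
  rw [artinSchreier_apply, sub_eq_zero, ← Subfield.mem_bot_iff_pow_eq_self K p]
  constructor
  · intro hx
    have h : (⊥ : Subfield K) ≤ (algebraMap (ZMod p) K).fieldRange := bot_le
    exact h hx
  · rintro ⟨y, rfl⟩
    rw [Subfield.mem_bot_iff_pow_eq_self K p, Algebra.linearMap_apply, ← map_pow, ZMod.pow_card]

variable (V : Type u) [AddCommGroup V] [Module (ZMod p) V]

/-- Every `𝔽_p`-module is flat, and `𝔽_p ⊗ V` is identified with `V`. -/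
theorem exact_artinSchreier_rTensor :
    Function.Exact (TensorProduct.mk (ZMod p) K V 1) ((artinSchreier p K).rTensor V) := by
  have h := Module.Flat.rTensor_exact (M := V) (exact_artinSchreier p K)
  intro x
  rw [h x]
  constructor
  · rintro ⟨y, rfl⟩
    obtain ⟨v, rfl⟩ := (TensorProduct.lid (ZMod p) V).symm.surjective y
    exact ⟨v, by simp⟩
  · rintro ⟨v, rfl⟩
    exact ⟨1 ⊗ₜ v, by simp⟩

theorem mk_one_injective : Function.Injective (TensorProduct.mk (ZMod p) K V 1) := by
  have h := Module.Flat.rTensor_preserves_injective_linearMap (M := V)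
    (Algebra.linearMap (ZMod p) K) (algebraMap (ZMod p) K).injective
  intro v w hvw
  have : (1 : ZMod p) ⊗ₜ[ZMod p] v = (1 : ZMod p) ⊗ₜ[ZMod p] w := h (by simpa using hvw)
  simpa using congrArg (TensorProduct.lid (ZMod p) V) this

end ArtinSchreier

/-! ### The discrete representation `E^sep ⊗ V`. -/

section TensorRep

open TopRep

variable {p : ℕ} [Fact p.Prime] {E Es : Type u} [Field E] [Field Es] [Algebra E Es]
  [Algebra (ZMod p) Es]

/-- The discrete representation `E^sep ⊗ V` with the diagonal action. -/
def tensorRep (V : TopRep.{u} (ZMod p) Gal(Es/E)) : TopRep.{u} (ZMod p) Gal(Es/E) :=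
  letI : TopologicalSpace (Es ⊗[ZMod p] V) := ⊥
  haveI : DiscreteTopology (Es ⊗[ZMod p] V) := ⟨rfl⟩
  haveI : ContinuousSMul (ZMod p) (Es ⊗[ZMod p] V) := ⟨continuous_of_discreteTopology⟩
  TopRep.of (X := Es ⊗[ZMod p] V) (ContRepresentation.ofMonoidHom
    { toFun := fun g => ⟨diagAction p V g, continuous_of_discreteTopology⟩
      map_one' := ContinuousLinearMap.ext fun x => LinearMap.congr_fun (map_one (diagAction p V)) x
      map_mul' := fun g h => ContinuousLinearMap.ext fun x =>
        LinearMap.congr_fun (map_mul (diagAction p V) g h) x })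

instance (V : TopRep.{u} (ZMod p) Gal(Es/E)) : DiscreteTopology (tensorRep V) := ⟨rfl⟩

/-- A linear equivariant map out of a discrete representation. -/
def homOfDiscrete {G : Type u} [Group G] {X Y : TopRep.{u} (ZMod p) G} [DiscreteTopology X]
    (f : X →ₗ[ZMod p] Y) (hf : ∀ g x, f (X.ρ g x) = Y.ρ g (f x)) : X ⟶ Y :=
  TopRep.ofHom ⟨⟨f, continuous_of_discreteTopology⟩, fun g => ContinuousLinearMap.ext (hf g)⟩

/-- The map `E^sep ⊗ V ⟶ E^sep ⊗ W` induced by `V ⟶ W`. -/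
def tensorMap {V W : TopRep.{u} (ZMod p) Gal(Es/E)} (f : V ⟶ W) : tensorRep V ⟶ tensorRep W :=
  homOfDiscrete (X := tensorRep V) (Y := tensorRep W)
    (f.hom.toContinuousLinearMap.toLinearMap.lTensor Es) (lTensor_diagAction f)

/-- The inclusion `v ↦ 1 ⊗ v`. -/
def tensorInclusion (V : TopRep.{u} (ZMod p) Gal(Es/E)) [DiscreteTopology V] : V ⟶ tensorRep V :=
  homOfDiscrete (Y := tensorRep V) (TensorProduct.mk (ZMod p) Es V 1) (fun g v => by
    change 1 ⊗ₜ V.ρ g v = g 1 ⊗ₜ V.ρ g v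
    rw [map_one])

theorem rTensor_artinSchreier_apply (V : TopRep.{u} (ZMod p) Gal(Es/E)) (x : Es ⊗[ZMod p] V) :
    (artinSchreier p Es).rTensor V x = frobTensor V x - x := by
  simp only [artinSchreier, LinearMap.rTensor_sub, LinearMap.sub_apply, LinearMap.rTensor_id,
    LinearMap.id_apply]
  rfl

theorem rTensor_artinSchreier_diagAction (V : TopRep.{u} (ZMod p) Gal(Es/E)) (g : Gal(Es/E))
    (x : Es ⊗[ZMod p] V) :
    (artinSchreier p Es).rTensor V (diagAction p V g x) =
      diagAction p V g ((artinSchreier p Es).rTensor V x) := by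
  rw [rTensor_artinSchreier_apply, rTensor_artinSchreier_apply, frobTensor_diagAction, map_sub]

/-- The map `σ ⊗ id - id` on `E^sep ⊗ V`. -/
def tensorFrobSubOne (V : TopRep.{u} (ZMod p) Gal(Es/E)) : tensorRep V ⟶ tensorRep V :=
  homOfDiscrete (X := tensorRep V) (Y := tensorRep V) ((artinSchreier p Es).rTensor V)
    (rTensor_artinSchreier_diagAction V)

theorem tensorFrobSubOne_apply (V : TopRep.{u} (ZMod p) Gal(Es/E)) (x : Es ⊗[ZMod p] V) :
    (tensorFrobSubOne V).hom x = frobTensor V x - x :=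
  rTensor_artinSchreier_apply V x

/-- Elements of `E^sep` are algebraic, so their stabilizers are open in the Krull topology. -/
theorem continuous_gal_apply [IsGalois E Es] [TopologicalSpace Es] [DiscreteTopology Es] (a : Es) :
    Continuous (fun g : Gal(Es/E) => g a) := by
  have : ContinuousSMul Gal(Es/E) Es :=
    continuousSMul_iff_stabilizer_isOpen.2 fun x => stabilizer_isOpen_of_isIntegral x
  exact continuous_id.smul continuous_const

/-- As the space is discrete, continuity of each orbit map suffices. It holds for pure tensors by
continuity in both factors, and passes to sums. -/
theorem continuous_tensorRep [IsGalois E Es] (V : TopRep.{u} (ZMod p) Gal(Es/E))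
    [DiscreteTopology V] (hV : Continuous (fun x : Gal(Es/E) × V => V.ρ x.1 x.2)) :
    Continuous (fun x : Gal(Es/E) × tensorRep V => (tensorRep V).ρ x.1 x.2) := by
  refine continuous_prod_of_discrete_right.2 fun x => ?_
  change Es ⊗[ZMod p] V at x
  induction x with
  | zero =>
    convert! (continuous_const : Continuous fun _ : Gal(Es/E) => (0 : tensorRep V)) using 2
  | add x y hx hy =>
    convert! hx.add hy using 2 with g
    exact map_add (diagAction p V g) x y
  | tmul a v =>
    let : TopologicalSpace Es := ⊥
    have : DiscreteTopology Es := ⟨rfl⟩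
    exact (continuous_of_discreteTopology (f := fun y : Es × V =>
      (show tensorRep V from y.1 ⊗ₜ[ZMod p] y.2))).comp
      ((continuous_gal_apply a).prodMk (hV.comp (.prodMk_left v)))

end TensorRep

/-! ### Exactness of `D` and the comparison with Galois cohomology. -/

section GaloisComparison

open TopRep

variable {p : ℕ} [Fact p.Prime] {E Es : Type u} [Field E] [Field Es] [Algebra E Es]
  [Algebra (ZMod p) Es]

/-- Fontaine's functor is exact. -/
theorem isShortExact_fontaineFunctor [ExpChar E p] [IsGalois E Es]
    (S : ShortComplex (ModPRep p Gal(Es/E))) (hS : ModPRep.IsShortExact S) :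
    EtalePhiModule.IsShortExact (S.map (fontaineFunctor p E Es)) := by
  obtain ⟨h₁, h₂, h₃⟩ := hS
  have := S.X₂.property.1
  let f := S.f.hom.hom.toContinuousLinearMap.toLinearMap
  let g := S.g.hom.hom.toContinuousLinearMap.toLinearMap
  have i₁ : Function.Injective (f.lTensor Es) :=
    Module.Flat.lTensor_preserves_injective_linearMap f h₁
  have i₂ : Function.Exact (f.lTensor Es) (g.lTensor Es) := Module.Flat.lTensor_exact Es h₂
  have i₃ : Function.Surjective (g.lTensor Es) := LinearMap.lTensor_surjective Es h₃
  refine ⟨fun x y hxy => Subtype.ext (i₁ (congrArg Subtype.val hxy)), fun x => ⟨fun hx => ?_, ?_⟩,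
    fun x => ?_⟩
  · change fontaineD S.X₂.obj at x
    obtain ⟨y, hy⟩ := (i₂ x.1).1 (congrArg Subtype.val hx)
    -- The preimage `y` is invariant because its image is and `f.lTensor Es` is injective.
    refine ⟨(⟨y, fun s => i₁ ?_⟩ : fontaineD S.X₁.obj), Subtype.ext hy⟩
    rw [lTensor_diagAction S.f.hom s y]
    change diagAction p _ s (f.lTensor Es y) = f.lTensor Es y
    rw [hy]
    exact x.2 s
  · rintro ⟨y, rfl⟩
    change fontaineD S.X₁.obj at y
    exact Subtype.ext ((i₂ _).2 ⟨y.1, rfl⟩)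
  · change fontaineD S.X₃.obj at x
    obtain ⟨y, hy⟩ := i₃ x.1
    -- Taking invariants is not right exact in general; here the trace argument turns an arbitrary
    -- lift `y` into an invariant lift.
    obtain ⟨z, hz, hz'⟩ := exists_fixed_of_semilinear (E := E)
      (fun s => (diagAction p S.X₂.obj s).toAddMonoidHom)
      (fun s t x => LinearMap.congr_fun (map_mul (diagAction p S.X₂.obj) s t) x)
      (fun s => (diagAction p S.X₃.obj s).toAddMonoidHom)
      (smulAddHom Es _) (diagAction_smul S.X₂.obj) (smulAddHom Es _) (diagAction_smul S.X₃.obj)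
      (one_smul Es) (g.lTensor Es).toAddMonoidHom (lTensor_diagAction S.g.hom)
      (fun c x => by
        change g.lTensor Es (c • x) = c • g.lTensor Es x
        induction x with
        | zero => simp
        | add x y hx hy => simp only [smul_add, map_add, hx, hy]
        | tmul a v => rfl) y
      ((isOpen_discrete {(show tensorRep S.X₂.obj from y)}).preimage
        ((continuous_tensorRep S.X₂.obj S.X₂.property.2.2).comp (.prodMk_left _)))
      (LinearMap.congr_fun (map_one (diagAction p S.X₂.obj)) y)
      (fun s => by
        change diagAction p _ s (g.lTensor Es y) = g.lTensor Es y
        rw [hy]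
        exact x.2 s)
    exact ⟨(⟨z, hz⟩ : fontaineD S.X₂.obj), Subtype.ext (hz'.trans hy)⟩

/-- The inclusion of `D(V)` into the homogeneous `0`-cochains of `E^sep ⊗ V`. -/
def fontaineDToCochains (V : TopRep.{u} (ZMod p) Gal(Es/E)) :
    AddCommGrpCat.of (fontaineD V) ⟶ ((ModPRep.cochains p Gal(Es/E)).obj (tensorRep V)).X 0 :=
  AddCommGrpCat.ofHom
    { toFun := fun x => cochainMk (X := tensorRep V) (n := 0)
        (ContinuousMap.const Gal(Es/E) (show tensorRep V from x.1))
        (fun g => ContinuousMap.ext fun _ => x.2 g)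
      map_zero' := rfl
      map_add' := fun _ _ => rfl }

theorem fontaineDToCochains_injective (V : TopRep.{u} (ZMod p) Gal(Es/E)) :
    Function.Injective (fontaineDToCochains V) := fun _ _ h =>
  Subtype.ext (DFunLike.congr_fun (F := C(Gal(Es/E), tensorRep V)) (congrArg cochainVal h) 1)

/-- A `0`-cocycle is a constant function, and a constant function is invariant exactly when its
value is fixed; so `H⁰` of the cochains of `E^sep ⊗ V` is `D(V)`. -/
theorem fontaineDToCochains_exact (V : TopRep.{u} (ZMod p) Gal(Es/E)) :
    Function.Exact (fontaineDToCochains V)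
      (((ModPRep.cochains p Gal(Es/E)).obj (tensorRep V)).d 0 1) := by
  intro x
  rw [d_cochain_eq_zero_iff (n := 0)]
  constructor
  · intro h
    let F : C(Gal(Es/E), tensorRep V) := cochainVal x
    have hF (s t) : F s = F t := DFunLike.congr_fun (F := C(Gal(Es/E), tensorRep V)) (h t) s
    refine ⟨(⟨F 1, fun g => ?_⟩ : fontaineD V), cochainVal_injective ?_⟩
    · have := DFunLike.congr_fun (F := C(Gal(Es/E), tensorRep V)) (ρ_cochainVal x g) 1
      change (tensorRep V).ρ g (F 1) = F 1
      change (tensorRep V).ρ g (F (g⁻¹ * 1)) = F 1 at this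
      rwa [hF (g⁻¹ * 1) 1] at this
    · exact ContinuousMap.ext fun t => hF 1 t
  · rintro ⟨y, rfl⟩ t
    rfl

variable [ExpChar E p] [IsGalois E Es]

/-- The comparison of `D(V) ⟶ D(V)` with the continuous cochains of `V`. -/
def galoisComparison [IsSepClosed Es] (V : ModPRep p Gal(Es/E)) :
    FiberComparison ((EtalePhiModule.complex p E).obj ((fontaineFunctor p E Es).obj V))
      ((ModPRep.cochains p Gal(Es/E)).obj V.obj)
      ((ModPRep.cochains p Gal(Es/E)).obj (tensorRep V.obj)) :=
  have := V.property.1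
  have hc := continuous_tensorRep V.obj V.property.2.2
  have hz : tensorInclusion V.obj ≫ tensorFrobSubOne V.obj = 0 :=
    TopRep.hom_ext (ContIntertwiningMap.ext (ContinuousLinearMap.ext fun v =>
      (exact_artinSchreier_rTensor p Es V.obj _).2 ⟨v, rfl⟩))
  have hS := shortExact_map_cochains (ShortComplex.mk _ _ hz) hc (mk_one_injective p Es V.obj)
    (exact_artinSchreier_rTensor p Es V.obj)
    (LinearMap.rTensor_surjective V.obj (artinSchreier_surjective p Es))
  { i := (ModPRep.cochains p Gal(Es/E)).map (tensorInclusion V.obj)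
    ψ := (ModPRep.cochains p Gal(Es/E)).map (tensorFrobSubOne V.obj)
    i_injective := CochainComplex.f_injective hS
    exact := CochainComplex.exact_f_g hS
    ψ_surjective := CochainComplex.g_surjective hS
    acyclic := cochains_acyclic (tensorRep V.obj) hc (smulAddHom Es (Es ⊗[ZMod p] V.obj))
      (diagAction_smul V.obj) (fun x => one_smul Es (show Es ⊗[ZMod p] V.obj from x))
    j₀ := fontaineDToCochains V.obj
    j₁ := fontaineDToCochains V.obj
    j₀_injective := fontaineDToCochains_injective V.obj
    j₁_injective := fontaineDToCochains_injective V.obj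
    j₀_exact := fontaineDToCochains_exact V.obj
    j₁_exact := fontaineDToCochains_exact V.obj
    ψ_j₀ := fun x => by
      have h : ((EtalePhiModule.complex p E).obj ((fontaineFunctor p E Es).obj V)).d 0 1 =
          AddCommGrpCat.ofHom (EtalePhiModule.phiSubOne _) := CochainComplex.of_d
          (EtalePhiModule.complexX ((fontaineFunctor p E Es).obj V))
          (EtalePhiModule.complexD ((fontaineFunctor p E Es).obj V)) 0
      rw [h]
      -- On constant functions `ψ` is `σ ⊗ id - id`, whose restriction to `D(V)` is `φ - 1`.
      exact cochainVal_injective (ContinuousMap.ext fun t => tensorFrobSubOne_apply V.obj x.1)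
    subsingleton := fun n => inferInstanceAs (Subsingleton PUnit) }

variable [IsSepClosed Es]

theorem galoisComparison_i_comp {V W : ModPRep p Gal(Es/E)} (f : V ⟶ W) :
    (galoisComparison V).i ≫ (ModPRep.cochains p Gal(Es/E)).map (tensorMap f.hom) =
      (ModPRep.cochains p Gal(Es/E)).map f.hom ≫ (galoisComparison W).i := by
  change (ModPRep.cochains p Gal(Es/E)).map _ ≫ (ModPRep.cochains p Gal(Es/E)).map _ =
    (ModPRep.cochains p Gal(Es/E)).map _ ≫ (ModPRep.cochains p Gal(Es/E)).map _
  rw [← Functor.map_comp, ← Functor.map_comp]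
  rfl

theorem galoisComparison_ψ_comp {V W : ModPRep p Gal(Es/E)} (f : V ⟶ W) :
    (galoisComparison V).ψ ≫ (ModPRep.cochains p Gal(Es/E)).map (tensorMap f.hom) =
      (ModPRep.cochains p Gal(Es/E)).map (tensorMap f.hom) ≫ (galoisComparison W).ψ := by
  change (ModPRep.cochains p Gal(Es/E)).map _ ≫ (ModPRep.cochains p Gal(Es/E)).map _ =
    (ModPRep.cochains p Gal(Es/E)).map _ ≫ (ModPRep.cochains p Gal(Es/E)).map _
  rw [← Functor.map_comp, ← Functor.map_comp]
  congr 1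
  refine TopRep.hom_ext (ContIntertwiningMap.ext (ContinuousLinearMap.ext fun x => ?_))
  change Es ⊗[ZMod p] V.obj at x
  exact LinearMap.congr_fun ((LinearMap.lTensor_comp_rTensor ..).trans
    (LinearMap.rTensor_comp_lTensor ..).symm) x

theorem galoisComparison_j₀_comp {V W : ModPRep p Gal(Es/E)} (f : V ⟶ W) :
    (galoisComparison V).j₀ ≫ ((ModPRep.cochains p Gal(Es/E)).map (tensorMap f.hom)).f 0 =
      ((EtalePhiModule.complex p E).map ((fontaineFunctor p E Es).map f)).f 0 ≫
        (galoisComparison W).j₀ := rfl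

theorem galoisComparison_j₁_comp {V W : ModPRep p Gal(Es/E)} (f : V ⟶ W) :
    (galoisComparison V).j₁ ≫ ((ModPRep.cochains p Gal(Es/E)).map (tensorMap f.hom)).f 0 =
      ((EtalePhiModule.complex p E).map ((fontaineFunctor p E Es).map f)).f 1 ≫
        (galoisComparison W).j₁ := rfl

/-- The isomorphism `ℋⁿ(D(V)) ≅ Hⁿ(G, V)`, natural in `V`. -/
def fontaineCohomologyIso (hD : ∀ S : ShortComplex (ModPRep p Gal(Es/E)), ModPRep.IsShortExact S →
    EtalePhiModule.IsShortExact (S.map (fontaineFunctor p E Es))) (n : ℕ) :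
    ((EtalePhiModule.cohomology p E).comp (fontaineFunctor p E Es) hD).H n ≅
      (ModPRep.cohomology p Gal(Es/E)).H n :=
  NatIso.ofComponents (fun V => ((galoisComparison V).homologyEquiv n).toAddCommGrpIso)
    (fun {V W} f => by
      refine AddCommGrpCat.ext fun b => ?_
      -- The pair of `b` and its image lies on the graph for `V`; pushing it to the graph for `W` is
      -- the naturality square.
      have h := (galoisComparison V).related_iff.2
        (rfl : (galoisComparison V).homologyEquiv n b = _)
      exact (galoisComparison W).related_iff.1 (h.map _ _ _ (galoisComparison_i_comp f)
        (galoisComparison_ψ_comp f) (galoisComparison_j₀_comp f) (galoisComparison_j₁_comp f)))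

/-- The isomorphism of cohomological functors between `ℋⁿ(D(V))` and `Hⁿ(G, V)`. -/
def fontaineDeltaFunctorIso (hD : ∀ S : ShortComplex (ModPRep p Gal(Es/E)),
    ModPRep.IsShortExact S → EtalePhiModule.IsShortExact (S.map (fontaineFunctor p E Es))) :
    DeltaFunctor.Iso ((EtalePhiModule.cohomology p E).comp (fontaineFunctor p E Es) hD)
      (ModPRep.cohomology p Gal(Es/E)) where
  iso := fontaineCohomologyIso hD
  comm S hS n := by
    refine AddCommGrpCat.ext fun b => ?_
    have h := (galoisComparison S.X₃).related_iff.2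
      (rfl : (galoisComparison S.X₃).homologyEquiv n b = _)
    have := S.X₂.property.1
    let f := S.f.hom.hom.toContinuousLinearMap.toLinearMap
    let g := S.g.hom.hom.toContinuousLinearMap.toLinearMap
    have hfg : Function.Exact (f.lTensor Es) (g.lTensor Es) := Module.Flat.lTensor_exact Es hS.2.1
    have hz : tensorMap S.f.hom ≫ tensorMap S.g.hom = 0 :=
      TopRep.hom_ext (ContIntertwiningMap.ext (ContinuousLinearMap.ext fun x =>
        (hfg _).2 ⟨x, rfl⟩))
    -- The chase for `δ` needs the cochains of `E^sep ⊗ S` to be exact as well; tensoring over the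
    -- field `𝔽_p` preserves exactness of `S`.
    have hT := shortExact_map_cochains (ShortComplex.mk _ _ hz)
      (continuous_tensorRep S.X₂.obj S.X₂.property.2.2)
      (Module.Flat.lTensor_preserves_injective_linearMap f hS.1) hfg
      (LinearMap.lTensor_surjective Es hS.2.2)
    refine (galoisComparison S.X₁).related_iff.1 (FiberComparison.Related.δ
      (F₁ := galoisComparison S.X₁) (F₂ := galoisComparison S.X₂) (F₃ := galoisComparison S.X₃)
      (EtalePhiModule.complex_shortExact _ (hD S hS)) (ModPRep.cochains_shortExact S hS)
      (CochainComplex.f_injective hT) (CochainComplex.exact_f_g hT 0)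
      (galoisComparison_i_comp S.f) (galoisComparison_i_comp S.g)
      (galoisComparison_ψ_comp S.f) (galoisComparison_j₀_comp S.g)
      (galoisComparison_j₁_comp S.f) h)

end GaloisComparison

end

theorem theorem2 (p : ℕ) [Fact p.Prime] (E Es : Type u) [Field E] [CharP E p] [Field Es]
    [Algebra E Es] [IsSepClosure E Es] [Algebra (ZMod p) Es] :
    ∃ (hD : ∀ S : ShortComplex (ModPRep p Gal(Es/E)), ModPRep.IsShortExact S →
        EtalePhiModule.IsShortExact (S.map (fontaineFunctor p E Es)))
      (e : DeltaFunctor.Iso ((EtalePhiModule.cohomology p E).comp (fontaineFunctor p E Es) hD)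
        (ModPRep.cohomology p Gal(Es/E))),
      ∀ (V : ModPRep p Gal(Es/E)) (v : V.obj) (m : fontaineD V.obj)
        (c : ((EtalePhiModule.cohomology p E).H 0).obj ((fontaineFunctor p E Es).obj V))
        (c' : ((ModPRep.cohomology p Gal(Es/E)).H 0).obj V),
        (m : Es ⊗[ZMod p] V.obj) = 1 ⊗ₜ[ZMod p] v →
          EtalePhiModule.IsClassOf c m → ModPRep.IsClassOf c' v →
            (e.iso 0).hom.app V c = c' := by
  have := IsSepClosure.sep_closed E (K := Es)
  refine ⟨isShortExact_fontaineFunctor, fontaineDeltaFunctorIso _, fun V v m c c' hm hc hc' => ?_⟩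
  obtain ⟨z, hz, rfl⟩ := hc'
  -- In degree `0` being related means having the same image in `K`: both `m` and the constant
  -- cochain `v` go to the constant function `1 ⊗ v`.
  refine (galoisComparison V).related_iff.1 ⟨m, _, hc, ⟨z, rfl, rfl⟩, cochainVal_injective ?_⟩
  refine ContinuousMap.ext fun t => ?_
  refine Eq.trans hm ?_
  have := DFunLike.congr_fun hz t
  exact congrArg (1 ⊗ₜ[ZMod p] ·) this.symm
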